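/- There are constants $c>0$ and $n_0\in\mathbb{N}$ such that for every $n\ge n_0$ there is a connected graph $G$ on $n$ vertices and a planar rectilinear grid drawing $d$ of $G$ such that every balanced drawn tree decomposition $(\mathcal T,\beta,\alpha)$ of $d$ has width at least $c\,n$. Here grid points are the points of $\mathbb{R}^2$ with coordinates in $\{0,1,2,\dots\}$. A rectilinear grid drawing maps the vertices of $G$ to distinct grid points and each edge to the segment joining its ends, which must be parallel to an axis; it is planar if no edge contains a vertex other than its ends and two edges meet only in common ends. The drawing is translated so that the smallest $x$- and the smallest $y$-coordinate of a vertex are $1$, and $R_d$ is the rectangle with corners $(0,0)$ and $(x_{\max}+1,y_{\max}+1)$, where $x_{\max},y_{\max}$ are the largest coordinates of vertices. A frame is a simple closed axis-parallel polygon with vertices at grid points (frames with the same point set are identified); its strict interior and strict exterior are the bounded and the unbounded component of its complement, and inside means in the strict interior or on the frame. A cutter of a frame $f$ is a simple axis-parallel path with vertices at grid points, with at least one edge, that lies inside $f$ and meets $f$ exactly in its two endpoints; together with each of the two arcs of $f$ between its endpoints it forms a frame. Of these two frames, $f_1(c)$ is the one that contains the lexicographically smallest grid point of $f$ that is not an end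 of $c$, and $f_2(c)$ is the other. A drawn tree decomposition of $d$ consists of a finite rooted binary tree $\mathcal T$, a map $\alpha$ from its nodes to frames and a map $\beta$ from its nodes to vertex sets such that $(\mathcal T,\beta)$ is a tree decomposition of $G$ and: (1) the root is mapped by $\alpha$ to $R_d$; (2) each internal node $v$ has exactly two children $v_1,v_2$ and a cutter $c_v$ of $\alpha(v)$, with $\alpha(v_i)=f_i(c_v)$ for $f=\alpha(v)$; (3) a node is a leaf if and only if the strict interior of its frame contains no grid point; (4) for a leaf $v$, $\beta(v)$ is the set $A(\alpha(v))$ of all vertices drawn on $\alpha(v)$ and all ends of edges with one end strictly inside and the other strictly outside $\alpha(v)$; (5) for an internal node $v$, $\beta(v)$ is the union of $A(\alpha(v))$, the set of vertices drawn on $c_v$, and the set of ends of edges with both ends inside $\alpha(v)$ that have, for some $i\in\{1,2\}$, one end strictly inside and the other strictly outside $\alpha(v_i)$. It is balanced if for every node $v$ and every child $w$ of $v$ the number of vertices of $G$ drawn strictly inside $\alpha(w)$ is at most $\tfrac23$ of the number drawn strictly inside $\alpha(v)$. The width is the maximum cost of a frame $\alpha(v)$. The cost of a frame $f$ is the sum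 of the number of corners of $f$ (the least number of vertices of a polygon with the same point set), the number of vertices of $G$ drawn on $f$, and the number of turning points in $f$. For a segment or a frame $P$, its enriched grid points are the points in which an edge of $P$ meets a segment that joins two grid points and is not parallel to that edge. A turning point is a pair $(p,e)$ of a point $p$ and an edge $e$ of $G$ such that either $p$ is the image of an end of $e$ and lies on $f$, or $p$ is not the image of an end of $e$, $p$ is an enriched grid point of both $f$ and the drawn edge $e$, and for at least one end $w$ of $e$ there is a nontrivial piece of the drawn edge that starts at $p$ in the direction of $w$ and has no enriched grid point, other than $p$, that is also an enriched grid point of $f$. -/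

import Mathlib

open scoped ENNReal

/-! ### Points, segments and lattice polylines -/

/-- Grid points: points of the plane with coordinates in `ℕ = {0, 1, 2, …}`. -/
abbrev GridPt : Type := ℕ × ℕ

/-- The grid point `p` as a point of the plane `ℝ²`. -/
def toPlane (p : GridPt) : ℝ × ℝ := ((p.1 : ℝ), (p.2 : ℝ))

/-- The closed line segment between two grid points. -/
def gridSeg (e : GridPt × GridPt) : Set (ℝ × ℝ) := segment ℝ (toPlane e.1) (toPlane e.2)

/-- The edges `(p₁,p₂), (p₂,p₃), …, (pₖ₋₁,pₖ)` of the vertex sequence `(p₁, …, pₖ)`. -/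
def polyEdges (l : List GridPt) : List (GridPt × GridPt) := l.zip l.tail

/-- `PlanePoints`: all points of the plane on the polyline with vertex sequence `l`. -/
def polyPoints (l : List GridPt) : Set (ℝ × ℝ) := {x | ∃ e ∈ polyEdges l, x ∈ gridSeg e}

/-- Every edge is parallel to the `X`- or the `Y`-axis. -/
def AxisParallel (l : List GridPt) : Prop :=
  ∀ e ∈ polyEdges l, e.1.1 = e.2.1 ∨ e.1.2 = e.2.2

/-- Planarity of a polyline: two different edges meet only in a common endpoint. -/
def PlaneEdges (l : List GridPt) : Prop :=
  (polyEdges l).Pairwise fun e e' => ∀ x ∈ gridSeg e ∩ gridSeg e',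
    ∃ g : GridPt, toPlane g = x ∧ (g = e.1 ∨ g = e.2) ∧ (g = e'.1 ∨ g = e'.2)

/-- An axis-parallel path `(c₁, …, cₖ)` with at least one edge: distinct grid points, axis-parallel
edges, no crossings. -/
structure IsAxisPath (l : List GridPt) : Prop where
  two_le : 2 ≤ l.length
  nodup : l.Nodup
  axisParallel : AxisParallel l
  plane : PlaneEdges l

/-- An axis-parallel cycle `(p₁, …, pₖ)`, `pₖ = p₁`: at least three distinct vertices, axis-parallel
edges, no crossings. -/
structure IsAxisCycle (l : List GridPt) : Prop where
  four_le : 4 ≤ l.length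
  closed : l.head? = l.getLast?
  nodup : l.tail.Nodup
  axisParallel : AxisParallel l
  plane : PlaneEdges l

/-! ### Frames -/

/-- A frame is an axis-parallel cycle. Two frames are regarded as equal when they have the same
points, and all notions below depend on the point set `Frame.points` only. -/
structure Frame where
  verts : List GridPt
  isAxisCycle : IsAxisCycle verts

namespace Frame

/-- The points of the plane on the frame. -/
def points (f : Frame) : Set (ℝ × ℝ) := polyPoints f.verts

/-- `x` is strictly inside `f`: it is off `f`, in a bounded component of the complement of `f`. -/
def StrictlyInside (f : Frame) (x : ℝ × ℝ) : Prop :=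
  x ∉ f.points ∧ Bornology.IsBounded (connectedComponentIn f.pointsᶜ x)

/-- `x` is strictly outside `f`: it is off `f`, in an unbounded component of the complement. -/
def StrictlyOutside (f : Frame) (x : ℝ × ℝ) : Prop :=
  x ∉ f.points ∧ ¬ Bornology.IsBounded (connectedComponentIn f.pointsᶜ x)

/-- `x` is inside `f` (possibly on `f`). -/
def Inside (f : Frame) (x : ℝ × ℝ) : Prop := x ∈ f.points ∨ f.StrictlyInside x

/-- The number of vertices of `f^min`, the cycle with the same points as `f` and the fewest
vertices. (A cycle is listed with its first vertex repeated at the end.) -/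
noncomputable def minVertices (f : Frame) : ℕ :=
  sInf {k | ∃ g : Frame, g.points = f.points ∧ k = g.verts.length - 1}

end Frame

/-- A cutter of `f`: an axis-parallel path inside `f` that meets `f` exactly in its two
endpoints. -/
structure IsCutter (f : Frame) (c : List GridPt) : Prop where
  isAxisPath : IsAxisPath c
  inside : ∀ x ∈ polyPoints c, f.Inside x
  meets : f.points ∩ polyPoints c = {x | ∃ g : GridPt,
    (c.head? = some g ∨ c.getLast? = some g) ∧ x = toPlane g}

/-- `f₁` and `f₂` are the first and the second frame associated with the frame `f` and the cutter
`c = (a, …, b)`. The frame `f`, with `a` and `b` inserted as vertices and listed from `a`, is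
`(a, A, b, B, a)`; the two associated frames are `(c, B, a)` and `(c, A reversed, a)`. The first one
is the one that contains the lexicographically smallest grid point of `f` other than `a` and `b`
(`f` may be listed in either direction, so this can be taken to be the one through `B`). -/
def AssociatedFrames (f : Frame) (c : List GridPt) (f₁ f₂ : Frame) : Prop :=
  ∃ (a b : GridPt) (M A B : List GridPt),
    c = [a] ++ M ++ [b] ∧
    IsAxisCycle ([a] ++ A ++ [b] ++ B ++ [a]) ∧
    polyPoints ([a] ++ A ++ [b] ++ B ++ [a]) = f.points ∧
    f₁.points = polyPoints (c ++ B ++ [a]) ∧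
    f₂.points = polyPoints (c ++ A.reverse ++ [a]) ∧
    ∃ p : GridPt, toPlane p ∈ f₁.points ∧
      toPlane p ∈ f.points ∧ p ≠ a ∧ p ≠ b ∧
      ∀ q : GridPt, toPlane q ∈ f.points → q ≠ a → q ≠ b → toLex p ≤ toLex q

/-! ### Enriched grid points -/

/-- The points in which the segment from `x` to `y` meets the line segments that connect two grid
points and are not parallel to it. -/
def enrichedSeg (x y : ℝ × ℝ) : Set (ℝ × ℝ) :=
  {p | p ∈ segment ℝ x y ∧ ∃ g h : GridPt, p ∈ gridSeg (g, h) ∧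
    (y.1 - x.1) * ((h.2 : ℝ) - g.2) ≠ (y.2 - x.2) * ((h.1 : ℝ) - g.1)}

/-- `EnrichedGridPoints` of a frame: the union of the above over its edges. Subdividing an edge at a
grid point does not change it. -/
def Frame.enriched (f : Frame) : Set (ℝ × ℝ) :=
  {p | ∃ e ∈ polyEdges f.verts, p ∈ enrichedSeg (toPlane e.1) (toPlane e.2)}

/-! ### Drawings -/

/-- A rectilinear grid drawing of `G`: distinct vertices are drawn on distinct grid points, and the
edge `{u, v}` is drawn as the segment between the images of `u` and `v`, which is axis-parallel. -/
structure RectilinearGridDrawing {V : Type} (G : SimpleGraph V) where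
  pos : V → GridPt
  injective : Function.Injective pos
  aligned : ∀ u v, G.Adj u v → (pos u).1 = (pos v).1 ∨ (pos u).2 = (pos v).2

namespace RectilinearGridDrawing

variable {V : Type} {G : SimpleGraph V}

/-- The point of the plane on which `v` is drawn. -/
def pt (d : RectilinearGridDrawing G) (v : V) : ℝ × ℝ := toPlane (d.pos v)

/-- The drawing is planar: an edge passes through no vertex but its endpoints, and two different
edges meet only in a common endpoint. -/
def IsPlanar (d : RectilinearGridDrawing G) : Prop :=
  (∀ u v w, G.Adj u v → d.pt w ∈ segment ℝ (d.pt u) (d.pt v) → w = u ∨ w = v) ∧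
  ∀ u v u' v', G.Adj u v → G.Adj u' v' → s(u, v) ≠ s(u', v') →
    ∀ x ∈ segment ℝ (d.pt u) (d.pt v) ∩ segment ℝ (d.pt u') (d.pt v'),
      ∃ w, d.pt w = x ∧ w ∈ s(u, v) ∧ w ∈ s(u', v')

/-- The drawing is translated so that the least `x`- and the least `y`-coordinate of a vertex
are `1`. -/
def IsNormalized (d : RectilinearGridDrawing G) : Prop :=
  (∀ v, 1 ≤ (d.pos v).1 ∧ 1 ≤ (d.pos v).2) ∧ (∃ v, (d.pos v).1 = 1) ∧ ∃ v, (d.pos v).2 = 1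

/-- The rectangular `R_d` of a normalized drawing, as a vertex sequence. -/
def rectangular [Fintype V] (d : RectilinearGridDrawing G) : List GridPt :=
  let X := (Finset.univ.sup fun v => (d.pos v).1) + 1
  let Y := (Finset.univ.sup fun v => (d.pos v).2) + 1
  [(0, 0), (0, Y), (X, Y), (X, 0), (0, 0)]

/-- `(x, {u, v})` is a turning point in `f`: either `x` is the image of `u` or of `v` and lies on
`f`, or `x` is another enriched grid point of both `f` and the drawn edge, and on at least one side
of `x` the drawn edge has an initial piece, from `x` to some `y ≠ x`, whose only enriched grid point
on `f` is `x`. -/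
def IsTurningPoint (d : RectilinearGridDrawing G) (f : Frame) (x : ℝ × ℝ) (u v : V) : Prop :=
  ((x = d.pt u ∨ x = d.pt v) ∧ x ∈ f.points) ∨
  ((x ≠ d.pt u ∧ x ≠ d.pt v) ∧ x ∈ enrichedSeg (d.pt u) (d.pt v) ∩ f.enriched ∧
    ∃ w, (w = u ∨ w = v) ∧ ∃ y ∈ segment ℝ x (d.pt w), y ≠ x ∧
      enrichedSeg x y ∩ f.enriched = {x})

/-- The set of turning points `(x, {u, v})` of the edges of the drawing in `f`. -/
def turningPoints (d : RectilinearGridDrawing G) (f : Frame) : Set ((ℝ × ℝ) × Sym2 V) :=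
  {q | ∃ u v, G.Adj u v ∧ q.2 = s(u, v) ∧ d.IsTurningPoint f q.1 u v}

/-- The cost of a frame: the number of vertices of `f^min`, plus the number of vertices of `G` drawn
on `f`, plus the number of turning points in `f`. -/
noncomputable def cost (d : RectilinearGridDrawing G) (f : Frame) : ℕ∞ :=
  (f.minVertices : ℕ∞) + {v | d.pt v ∈ f.points}.encard + (d.turningPoints f).encard

/-- The vertices drawn strictly inside `f`. -/
def verIn (d : RectilinearGridDrawing G) (f : Frame) : Set V := {v | f.StrictlyInside (d.pt v)}

/-- The vertices associated with a frame: those drawn on it, and the endpoints of the edges with one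
end strictly inside and the other strictly outside. -/
def verAsso (d : RectilinearGridDrawing G) (f : Frame) : Set V :=
  {u | d.pt u ∈ f.points ∨ ∃ v, G.Adj u v ∧
    ((f.StrictlyInside (d.pt u) ∧ f.StrictlyOutside (d.pt v)) ∨
     (f.StrictlyOutside (d.pt u) ∧ f.StrictlyInside (d.pt v)))}

/-- The vertices associated with a cutter `c` of `f`, where `f₁`, `f₂` are the frames associated
with `f` and `c`: those drawn on `c`, and the endpoints of the edges with both ends inside `f` that
have one end strictly inside and the other strictly outside some `fᵢ`. -/
def verAssoCutter (d : RectilinearGridDrawing G) (f : Frame) (c : List GridPt) (f₁ f₂ : Frame) :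
    Set V :=
  {u | d.pt u ∈ polyPoints c ∨ ∃ v, G.Adj u v ∧ f.Inside (d.pt u) ∧ f.Inside (d.pt v) ∧
    ∃ g, (g = f₁ ∨ g = f₂) ∧
      ((g.StrictlyInside (d.pt u) ∧ g.StrictlyOutside (d.pt v)) ∨
       (g.StrictlyOutside (d.pt u) ∧ g.StrictlyInside (d.pt v)))}

end RectilinearGridDrawing

/-! ### Decompositions -/

/-- `(T, β)` is a tree decomposition of `G`. -/
structure IsTreeDecomposition {V VT : Type} (G : SimpleGraph V) (T : SimpleGraph VT)
    (β : VT → Set V) : Prop where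
  isTree : T.IsTree
  connected : ∀ v : V, (T.induce {x | v ∈ β x}).Connected
  edge : ∀ u v, G.Adj u v → ∃ x, u ∈ β x ∧ v ∈ β x

/-- In the tree `T` rooted at `r`, the vertex `y` is a child of `x`. -/
def IsChild {VT : Type} (T : SimpleGraph VT) (r x y : VT) : Prop :=
  T.Adj x y ∧ T.dist r y = T.dist r x + 1

/-- A drawn tree decomposition `(T, β, α)` of the drawing `d`. -/
structure DrawnTreeDecomposition {V : Type} [Fintype V] {G : SimpleGraph V}
    (d : RectilinearGridDrawing G) where
  VT : Type
  finite : Finite VT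
  T : SimpleGraph VT
  root : VT
  β : VT → Set V
  α : VT → Frame
  isTreeDecomposition : IsTreeDecomposition G T β
  root_frame : (α root).points = polyPoints d.rectangular
  /-- An internal vertex `x` has exactly two children `x₁`, `x₂` and a cutter `c` of `α x`, with
  which the frames of the children and the bag of `x` are associated. -/
  internal : ∀ x, (∃ y, IsChild T root x y) → ∃ x₁ x₂, x₁ ≠ x₂ ∧
    (∀ y, IsChild T root x y ↔ y = x₁ ∨ y = x₂) ∧
    ∃ c, IsCutter (α x) c ∧ AssociatedFrames (α x) c (α x₁) (α x₂) ∧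
      β x = d.verAsso (α x) ∪ d.verAssoCutter (α x) c (α x₁) (α x₂)
  leaf_iff : ∀ x, (¬ ∃ y, IsChild T root x y) ↔
    ¬ ∃ g : GridPt, (α x).StrictlyInside (toPlane g)
  leaf_bag : ∀ x, (¬ ∃ y, IsChild T root x y) → β x = d.verAsso (α x)

namespace DrawnTreeDecomposition

variable {V : Type} [Fintype V] {G : SimpleGraph V} {d : RectilinearGridDrawing G}

/-- The width: the maximum cost of a frame of the decomposition. -/
noncomputable def width (D : DrawnTreeDecomposition d) : ℕ∞ := ⨆ x, d.cost (D.α x)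

/-- The decomposition is balanced: the frame of every child contains strictly inside at most `2/3`
of the vertices that are strictly inside the frame of its parent. -/
def IsBalanced (D : DrawnTreeDecomposition d) : Prop :=
  ∀ x y, IsChild D.T D.root x y →
    ((d.verIn (D.α y)).ncard : ℝ) ≤ 2 / 3 * ((d.verIn (D.α x)).ncard : ℝ)

end DrawnTreeDecomposition

/-! ### Polylines -/

/-! The drawing consists of `K` nested rectangles around a core: a straight path of `m > 10 * K`
vertices. The row that contains the core is extended to the left until it touches every rectangle,
which makes the graph connected. Since `n = 5 * K + m`, the core holds more than two thirds of all
vertices.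

The lower bound is already forced by the first cut. If the cutter of `R_d` misses the core, the core
lies strictly inside one child frame, against balance. If it meets the core, it joins the boundary
of `R_d` to the core, so by the intermediate value theorem for the distance to the boundary
(`ringDepth`) it crosses all `K` rectangles. A frame that meets a drawn edge has a turning point on
it (`exists_turningPoint`), so a child frame, which contains the cutter, has `K` turning points on
distinct edges (`le_cost_of_crossing`).

Placing the core inside a child needs only a weak form of the Jordan curve theorem: a point whose
upward ray crosses a closed polyline an odd number of times lies in a bounded component. The frame
and the two frames cut from it form a theta curve, whose three parities add up to zero mod 2. The
core is odd for `R_d`, hence odd for exactly one child (`AssociatedFrames.strictlyInside`). -/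

theorem polyEdges_cons_cons (a b : GridPt) (l : List GridPt) :
    polyEdges (a :: b :: l) = (a, b) :: polyEdges (b :: l) := rfl

theorem polyEdges_append_cons (l : List GridPt) (p : GridPt) (l' : List GridPt) :
    polyEdges (l ++ p :: l') = polyEdges (l ++ [p]) ++ polyEdges (p :: l') := by
  induction l with
  | nil => simp [polyEdges]
  | cons a l ih =>
    cases l with
    | nil => simp [polyEdges]
    | cons b l => simpa [polyEdges_cons_cons] using ih

theorem mem_polyEdges_reverse {l : List GridPt} {e : GridPt × GridPt} :
    e ∈ polyEdges l.reverse ↔ e.swap ∈ polyEdges l := by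
  induction l with
  | nil => simp [polyEdges]
  | cons a l ih =>
    cases l with
    | nil => simp [polyEdges]
    | cons b l =>
      have : (a :: b :: l).reverse = l.reverse ++ b :: [a] := by simp
      rw [this, polyEdges_append_cons, List.mem_append, polyEdges_cons_cons a, List.mem_cons,
        ← ih, List.reverse_cons]
      obtain ⟨p, q⟩ := e
      simp [polyEdges]
      tauto

theorem AxisParallel.reverse {l : List GridPt} (h : AxisParallel l) : AxisParallel l.reverse := by
  intro e he
  have := h _ (mem_polyEdges_reverse.1 he)
  simpa [eq_comm] using this

theorem polyPoints_reverse (l : List GridPt) : polyPoints l.reverse = polyPoints l := by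
  have key : ∀ l : List GridPt, polyPoints l ⊆ polyPoints l.reverse := by
    rintro l x ⟨e, he, hx⟩
    refine ⟨e.swap, mem_polyEdges_reverse.2 (by simpa using he), ?_⟩
    simpa [gridSeg, segment_symm] using hx
  exact Set.Subset.antisymm (by simpa using key l.reverse) (key l)

theorem polyPoints_cons_cons (a b : GridPt) (l : List GridPt) :
    polyPoints (a :: b :: l) = gridSeg (a, b) ∪ polyPoints (b :: l) := by
  ext x
  simp [polyPoints, polyEdges_cons_cons]

theorem polyPoints_append_cons (l : List GridPt) (p : GridPt) (l' : List GridPt) :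
    polyPoints (l ++ p :: l') = polyPoints (l ++ [p]) ∪ polyPoints (p :: l') := by
  ext x
  simp only [polyPoints, polyEdges_append_cons l p l', List.mem_append, Set.mem_union,
    Set.mem_ofPred_eq, or_and_right, exists_or]

theorem axisParallel_append_cons {l : List GridPt} {p : GridPt} {l' : List GridPt} :
    AxisParallel (l ++ p :: l') ↔ AxisParallel (l ++ [p]) ∧ AxisParallel (p :: l') := by
  simp only [AxisParallel, polyEdges_append_cons l p l', List.mem_append, or_imp, forall_and]

theorem isCompact_polyPoints (l : List GridPt) : IsCompact (polyPoints l) := by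
  have : polyPoints l = ⋃ e ∈ {e | e ∈ polyEdges l}, gridSeg e := by
    ext x; simp [polyPoints]
  rw [this]
  refine (List.finite_toSet _).isCompact_biUnion fun e _ => ?_
  rw [gridSeg, segment_eq_image_lineMap]
  exact isCompact_Icc.image AffineMap.lineMap_continuous

theorem isPreconnected_polyPoints (l : List GridPt) : IsPreconnected (polyPoints l) := by
  induction l with
  | nil => simpa [polyPoints, polyEdges] using isPreconnected_empty
  | cons a l ih =>
    cases l with
    | nil => simpa [polyPoints, polyEdges] using isPreconnected_empty
    | cons b l =>
      have hs : IsPreconnected (gridSeg (a, b)) := (convex_segment _ _).isPreconnected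
      rw [polyPoints_cons_cons]
      cases l with
      | nil => simpa [polyPoints, polyEdges] using hs
      | cons c l =>
        refine hs.union (toPlane b) (right_mem_segment _ _ _) ?_ ih
        rw [polyPoints_cons_cons]
        exact Or.inl (left_mem_segment _ _ _)

/-- An axis-parallel segment is a (degenerate) box. -/
theorem mem_gridSeg_iff {p q : GridPt} (h : p.1 = q.1 ∨ p.2 = q.2) {x : ℝ × ℝ} :
    x ∈ gridSeg (p, q) ↔
      x.1 ∈ Set.uIcc (p.1 : ℝ) q.1 ∧ x.2 ∈ Set.uIcc (p.2 : ℝ) q.2 := by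
  obtain ⟨x, y⟩ := x
  rw [← segment_eq_uIcc, ← segment_eq_uIcc]
  rcases h with h | h
  · simp only [gridSeg, toPlane, h, ← Prod.image_mk_segment_right, segment_same,
      Set.mem_image, Set.mem_singleton_iff, Prod.mk.injEq]
    constructor
    · rintro ⟨y, hy, rfl, rfl⟩; exact ⟨rfl, hy⟩
    · rintro ⟨rfl, hy⟩; exact ⟨y, hy, rfl, rfl⟩
  · simp only [gridSeg, toPlane, h, ← Prod.image_mk_segment_left, segment_same,
      Set.mem_image, Set.mem_singleton_iff, Prod.mk.injEq]
    constructor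
    · rintro ⟨y, hy, rfl, rfl⟩; exact ⟨hy, rfl⟩
    · rintro ⟨hy, rfl⟩; exact ⟨x, hy, rfl, rfl⟩

/-! ### Parity of the number of crossings with an upward vertical ray -/

/-- Whether `p` is higher than `z`. -/
noncomputable def aboveInd (z : ℝ × ℝ) (p : GridPt) : ZMod 2 := if z.2 < p.2 then 1 else 0

/-- Whether `p` is weakly to the left of `z`. -/
noncomputable def leftInd (z : ℝ × ℝ) (p : GridPt) : ZMod 2 := if (p.1 : ℝ) ≤ z.1 then 1 else 0

/-- The contribution of an axis-parallel edge to the number of crossings with the upward vertical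
ray from `z`. -/
noncomputable def edgeParity (z : ℝ × ℝ) (e : GridPt × GridPt) : ZMod 2 :=
  aboveInd z e.1 * (leftInd z e.1 + leftInd z e.2)

/-- The parity of the number of edges of an axis-parallel polyline that cross the upward vertical
ray from `z`. -/
noncomputable def rayParity (z : ℝ × ℝ) (l : List GridPt) : ZMod 2 :=
  ((polyEdges l).map (edgeParity z)).sum

theorem rayParity_append_cons (z : ℝ × ℝ) (l : List GridPt) (p : GridPt) (l' : List GridPt) :
    rayParity z (l ++ p :: l') = rayParity z (l ++ [p]) + rayParity z (p :: l') := by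
  simp [rayParity, polyEdges_append_cons l p l']

theorem rayParity_cons_cons (z : ℝ × ℝ) (a b : GridPt) (l : List GridPt) :
    rayParity z (a :: b :: l) = edgeParity z (a, b) + rayParity z (b :: l) := by
  simp [rayParity, polyEdges_cons_cons]

/-- A vertical edge has equal `leftInd` at its ends and contributes zero; a horizontal edge has
equal `aboveInd` at its ends. So the asymmetric use of the first end in `edgeParity` does no harm.
-/
theorem edgeParity_swap (z : ℝ × ℝ) {a b : GridPt} (h : a.1 = b.1 ∨ a.2 = b.2) :
    edgeParity z (b, a) = edgeParity z (a, b) := by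
  rcases h with h | h
  · simp [edgeParity, leftInd, h, CharTwo.add_self_eq_zero]
  · simp [edgeParity, aboveInd, h, add_comm]

theorem rayParity_reverse (z : ℝ × ℝ) {l : List GridPt} (h : AxisParallel l) :
    rayParity z l.reverse = rayParity z l := by
  induction l with
  | nil => rfl
  | cons a l ih =>
    cases l with
    | nil => rfl
    | cons b l =>
      have : (a :: b :: l).reverse = l.reverse ++ b :: [a] := by simp
      have hh := (axisParallel_append_cons (l := [a]) (p := b) (l' := l)).1 h
      rw [this, rayParity_append_cons, rayParity_cons_cons, rayParity_cons_cons z a, ← ih hh.2,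
        ← List.reverse_cons, edgeParity_swap z (h (a, b) (by simp [polyEdges_cons_cons]))]
      simp [rayParity, polyEdges, add_comm]

/-- Telescoping in characteristic 2: each inner vertex is counted twice, and the two ends coincide.
-/
theorem sum_polyEdges_add (g : GridPt → ZMod 2) {l : List GridPt} (h : l.head? = l.getLast?) :
    ((polyEdges l).map fun e => g e.1 + g e.2).sum = 0 := by
  have key : ∀ (l : List GridPt) (a b : GridPt), l.head? = some a → l.getLast? = some b →
      ((polyEdges l).map fun e => g e.1 + g e.2).sum = g a + g b := by
    intro l
    induction l with
    | nil => simp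
    | cons a l ih =>
      intro a' b ha hb
      cases l with
      | nil =>
        simp at ha hb
        subst ha hb
        simp [polyEdges, CharTwo.add_self_eq_zero]
      | cons c l =>
        simp only [List.head?_cons, Option.some.injEq] at ha
        subst ha
        rw [polyEdges_cons_cons, List.map_cons, List.sum_cons,
          ih c b rfl (by simpa using hb)]
        have := CharTwo.add_self_eq_zero (g c)
        linear_combination this
  cases l with
  | nil => simp [polyEdges]
  | cons a l => rw [key _ a a rfl (by rw [← h]; rfl), CharTwo.add_self_eq_zero]

/-- The change of the parity is compared edge by edge with the coboundary of `aboveInd` times the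
change of `leftInd`, which sums to zero over a closed polyline. -/
theorem rayParity_eq_of_horizontal {l : List GridPt} (hc : l.head? = l.getLast?)
    (hl : AxisParallel l) {x x' y : ℝ} (hxx : x' ≤ x)
    (h : ∀ t ∈ Set.Icc x' x, (t, y) ∉ polyPoints l) :
    rayParity (x', y) l = rayParity (x, y) l := by
  rw [← CharTwo.add_eq_zero, rayParity, rayParity, ← List.sum_map_add, ← sum_polyEdges_add
    (fun p => aboveInd (x, y) p * (leftInd (x', y) p + leftInd (x, y) p)) hc]
  congr 1
  refine List.map_congr_left fun e he => ?_
  obtain ⟨p, q⟩ := e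
  have hpq := hl _ he
  have hab : ∀ p, aboveInd (x', y) p = aboveInd (x, y) p := fun p => rfl
  simp only [edgeParity, hab]
  rcases hpq with hpq | hpq
  · simp only at hpq
    -- Only a vertical edge in the swept strip could make a difference. It avoids the swept segment,
    -- so both its ends are on the same side of height `y`.
    by_cases hx : x' < p.1 ∧ (p.1 : ℝ) ≤ x
    · have hno : ¬ (y ∈ Set.uIcc (p.2 : ℝ) q.2) := fun hy => h p.1 ⟨hx.1.le, hx.2⟩
        ⟨_, he, (mem_gridSeg_iff (Or.inl hpq)).2 ⟨by simp, hy⟩⟩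
      have : aboveInd (x, y) p = aboveInd (x, y) q := by
        simp only [aboveInd]
        rw [Set.mem_uIcc] at hno
        push Not at hno
        split_ifs with h1 h2 h2
        · rfl
        · exact absurd (hno.2 (not_lt.1 h2)) (not_lt.2 h1.le)
        · exact absurd (hno.1 (not_lt.1 h1)) (not_lt.2 h2.le)
        · rfl
      rw [this]; ring
    · have : leftInd (x', y) p = leftInd (x, y) p := by
        simp only [leftInd]
        push Not at hx
        split_ifs with h1 h2 h2
        · rfl
        · exact absurd (h1.trans hxx) h2
        · exact absurd (hx (not_le.1 h1)) (not_lt.2 h2)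
        · rfl
      have h2 : leftInd (x', y) q = leftInd (x, y) q := by
        simpa only [leftInd, ← hpq] using this
      rw [this, h2]; simp [CharTwo.add_self_eq_zero]
  · have : aboveInd (x, y) p = aboveInd (x, y) q := by
      simp only at hpq
      simp [aboveInd, hpq]
    rw [this]; ring

theorem edgeParity_ne_zero {z : ℝ × ℝ} {p q : GridPt} (hpq : p.1 = q.1 ∨ p.2 = q.2)
    (h : edgeParity z (p, q) ≠ 0) :
    z.2 < p.2 ∧ p.2 = q.2 ∧ (z.1, (p.2 : ℝ)) ∈ gridSeg (p, q) := by
  have h1 : z.2 < p.2 := by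
    by_contra h1
    simp [edgeParity, aboveInd, h1] at h
  have h2 : leftInd z p + leftInd z q ≠ 0 := by
    intro h2
    simp [edgeParity, h2] at h
  have h3 : ¬ (p.1 : ℝ) ≤ z.1 ∨ ¬ (q.1 : ℝ) ≤ z.1 := by
    by_contra h3
    push Not at h3
    simp [leftInd, h3, CharTwo.add_self_eq_zero] at h2
  have h4 : (p.1 : ℝ) ≤ z.1 ∨ (q.1 : ℝ) ≤ z.1 := by
    by_contra h4
    push Not at h4
    simp [leftInd, not_le.2 h4.1, not_le.2 h4.2] at h2
  have h5 : p.2 = q.2 := by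
    refine hpq.resolve_left fun h5 => ?_
    rw [h5] at h3 h4
    tauto
  refine ⟨h1, h5, (mem_gridSeg_iff hpq).2 ⟨?_, by simp⟩⟩
  rw [Set.mem_uIcc]
  push Not at h3
  rcases h3 with h3 | h3 <;> rcases h4 with h4 | h4
  · linarith
  · exact Or.inr ⟨h4, h3.le⟩
  · exact Or.inl ⟨h4, h3.le⟩
  · linarith

/-- A vertical move leaves `leftInd` alone. An edge whose height is swept could change its
contribution only by being horizontal and crossing the vertical line, and then it would meet the
swept segment. -/
theorem rayParity_eq_of_vertical {l : List GridPt}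
    (hl : AxisParallel l) {x y y' : ℝ} (hyy : y' ≤ y)
    (h : ∀ t ∈ Set.Icc y' y, (x, t) ∉ polyPoints l) :
    rayParity (x, y') l = rayParity (x, y) l := by
  rw [rayParity, rayParity]
  congr 1
  refine List.map_congr_left fun e he => ?_
  obtain ⟨p, q⟩ := e
  have hle : ∀ p, leftInd (x, y') p = leftInd (x, y) p := fun p => rfl
  by_cases hy : y' < p.2 ∧ (p.2 : ℝ) ≤ y
  · have h1 : edgeParity (x, y) (p, q) = 0 := by
      simp [edgeParity, aboveInd, hy.2]
    rw [h1]
    by_contra hne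
    exact h p.2 ⟨hy.1.le, hy.2⟩ ⟨_, he, (edgeParity_ne_zero (hl _ he) hne).2.2⟩
  · have : aboveInd (x, y') p = aboveInd (x, y) p := by
      simp only [aboveInd]
      push Not at hy
      split_ifs with h1 h2 h2
      · rfl
      · exact absurd (hy h1) h2
      · exact absurd (hyy.trans_lt h2) h1
      · rfl
    simp only [edgeParity, hle, this]

theorem rayParity_eq_of_mem_connectedComponentIn {l : List GridPt} (hc : l.head? = l.getLast?)
    (hl : AxisParallel l) {z w : ℝ × ℝ} (hw : w ∈ connectedComponentIn (polyPoints l)ᶜ z) :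
    rayParity w l = rayParity z l := by
  have hz : z ∈ (polyPoints l)ᶜ := by
    by_contra hz
    simp [connectedComponentIn_eq_empty hz] at hw
  have hloc : ∀ u ∈ (polyPoints l)ᶜ, ∀ᶠ v in nhds u, rayParity v l = rayParity u l := by
    intro u hu
    obtain ⟨r, hr, hball⟩ := Metric.isOpen_iff.1 (isCompact_polyPoints l).isClosed.isOpen_compl u hu
    filter_upwards [Metric.ball_mem_nhds u hr] with v hv
    -- Balls of the sup metric are products of intervals, so the path of one vertical and one
    -- horizontal move between two points stays in the ball.
    obtain ⟨a, b⟩ := u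
    obtain ⟨a', b'⟩ := v
    rw [← ball_prod_same] at hv hball
    have ha : a ∈ Metric.ball a r := Metric.mem_ball_self hr
    have hb : b ∈ Metric.ball b r := Metric.mem_ball_self hr
    have hcx := (convex_ball a r).ordConnected
    have hcy := (convex_ball b r).ordConnected
    trans rayParity (a', b) l
    · rcases le_total b b' with h | h
      · exact (rayParity_eq_of_vertical hl h fun t ht =>
          hball ⟨hv.1, hcy.out hb hv.2 ht⟩).symm
      · exact rayParity_eq_of_vertical hl h fun t ht => hball ⟨hv.1, hcy.out hv.2 hb ht⟩
    · rcases le_total a a' with h | h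
      · exact (rayParity_eq_of_horizontal hc hl h fun t ht =>
          hball ⟨hcx.out ha hv.1 ht, hb⟩).symm
      · exact rayParity_eq_of_horizontal hc hl h fun t ht => hball ⟨hcx.out hv.1 ha ht, hb⟩
  refine isPreconnected_connectedComponentIn.constant (f := fun v => rayParity v l)
    (fun u hu => ?_) hw (mem_connectedComponentIn hz)
  refine ContinuousAt.continuousWithinAt ?_
  refine (continuousAt_const (y := rayParity u l)).congr ?_
  filter_upwards [hloc u (connectedComponentIn_subset _ _ hu)] with v hv using hv.symm

theorem exists_coord_bound (l : List GridPt) : ∃ N : ℕ, ∀ p ∈ l, p.1 ≤ N ∧ p.2 ≤ N := by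
  induction l with
  | nil => exact ⟨0, by simp⟩
  | cons a l ih =>
    obtain ⟨N, hN⟩ := ih
    refine ⟨a.1 + a.2 + N, fun p hp => ?_⟩
    rcases List.mem_cons.1 hp with rfl | hp
    · omega
    · have := hN p hp; omega

theorem mem_of_mem_polyEdges {l : List GridPt} {e : GridPt × GridPt} (he : e ∈ polyEdges l) :
    e.1 ∈ l ∧ e.2 ∈ l := by
  obtain ⟨p, q⟩ := e
  have := List.of_mem_zip he
  exact ⟨this.1, List.mem_of_mem_tail this.2⟩

/-- The parity is constant on the component and vanishes outside `[0, N]²`: to the left and above no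
edge is counted, to the right the two `leftInd` of an edge cancel, and below the sum telescopes. -/
theorem isBounded_connectedComponentIn_of_rayParity {l : List GridPt} (hc : l.head? = l.getLast?)
    (hl : AxisParallel l) {z : ℝ × ℝ} (h : rayParity z l = 1) :
    Bornology.IsBounded (connectedComponentIn (polyPoints l)ᶜ z) := by
  obtain ⟨N, hN⟩ := exists_coord_bound l
  refine ((Metric.isBounded_Icc (0 : ℝ) N).prod (Metric.isBounded_Icc (0 : ℝ) N)).subset ?_
  intro w hw
  have h1 := (rayParity_eq_of_mem_connectedComponentIn hc hl hw).trans h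
  have hN' : ∀ p ∈ l, (p.1 : ℝ) ≤ N ∧ (p.2 : ℝ) ≤ N := fun p hp => by
    exact_mod_cast hN p hp
  have hzero : (∀ e ∈ polyEdges l, edgeParity w e = 0) → False := by
    intro h0
    rw [rayParity, List.map_congr_left (g := fun _ => 0) h0] at h1
    simp at h1
  have hx0 : 0 ≤ w.1 := by
    by_contra hx
    refine hzero fun e _ => ?_
    have : ∀ p : GridPt, leftInd w p = 0 := fun p => by
      have : ¬ (p.1 : ℝ) ≤ w.1 := fun h => hx ((Nat.cast_nonneg _).trans h)
      simp [leftInd, this]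
    simp [edgeParity, this]
  have hxN : w.1 ≤ N := by
    by_contra hx
    refine hzero fun e he => ?_
    have : ∀ p ∈ l, leftInd w p = 1 := fun p hp => by
      have : (p.1 : ℝ) ≤ w.1 := (hN' p hp).1.trans (not_le.1 hx).le
      simp [leftInd, this]
    rw [edgeParity, this _ (mem_of_mem_polyEdges he).1, this _ (mem_of_mem_polyEdges he).2,
      CharTwo.add_self_eq_zero, mul_zero]
  have hyN : w.2 ≤ N := by
    by_contra hy
    refine hzero fun e he => ?_
    have : ¬ w.2 < e.1.2 :=
      fun h => hy (h.le.trans (hN' _ (mem_of_mem_polyEdges he).1).2)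
    simp [edgeParity, aboveInd, this]
  have hy0 : 0 ≤ w.2 := by
    by_contra hy
    have : ∀ e, edgeParity w e = leftInd w e.1 + leftInd w e.2 := fun e => by
      have : w.2 < e.1.2 := (not_le.1 hy).trans_le (Nat.cast_nonneg _)
      simp [edgeParity, aboveInd, this]
    rw [rayParity, List.map_congr_left (fun e _ => this e), sum_polyEdges_add _ hc] at h1
    simp at h1
  exact ⟨⟨hx0, hxN⟩, ⟨hy0, hyN⟩⟩

/-- A connected set that avoids `f` and contains a point of odd parity is strictly inside `f`. -/
theorem Frame.strictlyInside_of_rayParity {f : Frame} {l : List GridPt}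
    (hf : f.points = polyPoints l) (hc : l.head? = l.getLast?) (hl : AxisParallel l)
    {C : Set (ℝ × ℝ)} (hC : IsPreconnected C) (hd : ∀ x ∈ C, x ∉ polyPoints l)
    {z : ℝ × ℝ} (hz : z ∈ C) (h : rayParity z l = 1) {x : ℝ × ℝ} (hx : x ∈ C) :
    f.StrictlyInside x := by
  refine ⟨hf ▸ hd x hx, ?_⟩
  have : x ∈ connectedComponentIn (polyPoints l)ᶜ z :=
    hC.subset_connectedComponentIn hz (fun y hy => hd y hy) hx
  rw [hf, ← connectedComponentIn_eq this]
  exact isBounded_connectedComponentIn_of_rayParity hc hl h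

/-! ### Enriched grid points and turning points -/

theorem toPlane_injective : Function.Injective toPlane := by
  rintro ⟨a, b⟩ ⟨c, d⟩ h
  simpa [toPlane] using h

/-- Degenerate edges must be excluded because `enrichedSeg x x` is empty. The first edge is the only
one not covered by `nodup`; were it degenerate, its second end would recur as the last vertex. -/
theorem IsAxisCycle.fst_ne_snd {l : List GridPt} (hl : IsAxisCycle l) {e : GridPt × GridPt}
    (he : e ∈ polyEdges l) : e.1 ≠ e.2 := by
  have key : ∀ (l : List GridPt), l.Nodup → ∀ e ∈ polyEdges l, e.1 ≠ e.2 := by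
    intro l hl e he
    induction l with
    | nil => simp [polyEdges] at he
    | cons a l ih =>
      cases l with
      | nil => simp [polyEdges] at he
      | cons b l =>
        rw [polyEdges_cons_cons, List.mem_cons] at he
        rcases he with rfl | he
        · simp only [List.nodup_cons, List.mem_cons, not_or] at hl
          exact hl.1.1
        · exact ih (List.nodup_cons.1 hl).2 he
  have hn := hl.nodup
  have h4 := hl.four_le
  have hc := hl.closed
  match l, he with
  | a :: b :: c :: l, he =>
    rw [polyEdges_cons_cons, List.mem_cons] at he
    rcases he with rfl | he
    · intro hab
      have : b ∈ c :: l := by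
        refine List.mem_of_getLast? (?_ : (c :: l).getLast? = some b)
        rw [← show a = b from hab]
        simpa using hc.symm
      exact (List.nodup_cons.1 hn).1 this
    · exact key _ hn e he

/-- Of the unit grid segments going up and to the right from `g`, at least one is not parallel to
the given segment. -/
theorem mem_enrichedSeg {x y : ℝ × ℝ} (hxy : x ≠ y) {g : GridPt}
    (hg : toPlane g ∈ segment ℝ x y) : toPlane g ∈ enrichedSeg x y := by
  refine ⟨hg, g, ?_⟩
  by_cases h : y.2 = x.2
  · refine ⟨(g.1, g.2 + 1), left_mem_segment _ _ _, ?_⟩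
    have : y.1 - x.1 ≠ 0 := fun h1 => hxy (Prod.ext (by linarith) h.symm)
    simpa [h] using this
  · refine ⟨(g.1 + 1, g.2), left_mem_segment _ _ _, ?_⟩
    have : y.2 - x.2 ≠ 0 := fun h1 => h (by linarith)
    simpa using this.symm

theorem Frame.enriched_subset (f : Frame) : f.enriched ⊆ f.points := by
  rintro x ⟨e, he, hx⟩
  exact ⟨e, he, hx.1⟩

theorem Frame.mem_enriched {f : Frame} {g : GridPt} (hg : toPlane g ∈ f.points) :
    toPlane g ∈ f.enriched := by
  obtain ⟨e, he, hx⟩ := hg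
  exact ⟨e, he, mem_enrichedSeg (fun h => f.isAxisCycle.fst_ne_snd he (toPlane_injective h)) hx⟩

/-- A nonnegative real `t` rounded to an integer in the direction of `u`. -/
theorem exists_round_toward (t : ℝ) (ht : 0 ≤ t) (u : ℕ) :
    ∃ r : ℕ, |(r : ℝ) - u| ≤ |t - u| ∧ (|(r : ℝ) - u| = |t - u| → (r : ℝ) = t) ∧
      ∀ a b : ℕ, t ∈ Set.uIcc (a : ℝ) b → (r : ℝ) ∈ Set.uIcc (a : ℝ) b := by
  rcases le_total (u : ℝ) t with h | h
  · have h1 : (u : ℝ) ≤ ⌊t⌋₊ := by exact_mod_cast Nat.le_floor h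
    have h2 : (⌊t⌋₊ : ℝ) ≤ t := Nat.floor_le ht
    refine ⟨⌊t⌋₊, ?_, ?_, fun a b hab => ?_⟩
    · rw [abs_of_nonneg (by linarith), abs_of_nonneg (by linarith)]; linarith
    · rw [abs_of_nonneg (by linarith), abs_of_nonneg (by linarith)]; intro; linarith
    · rw [Set.mem_uIcc] at hab ⊢
      refine hab.imp (fun hab => ⟨?_, h2.trans hab.2⟩) (fun hab => ⟨?_, h2.trans hab.2⟩)
      all_goals exact_mod_cast Nat.le_floor hab.1
  · have h1 : (⌈t⌉₊ : ℝ) ≤ u := by exact_mod_cast Nat.ceil_le.2 h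
    have h2 : t ≤ ⌈t⌉₊ := Nat.le_ceil t
    refine ⟨⌈t⌉₊, ?_, ?_, fun a b hab => ?_⟩
    · rw [abs_of_nonpos (by linarith), abs_of_nonpos (by linarith)]; linarith
    · rw [abs_of_nonpos (by linarith), abs_of_nonpos (by linarith)]; intro; linarith
    · rw [Set.mem_uIcc] at hab ⊢
      refine hab.imp (fun hab => ⟨hab.1.trans h2, ?_⟩) (fun hab => ⟨hab.1.trans h2, ?_⟩)
      all_goals exact_mod_cast Nat.ceil_le.2 hab.2

/-- A frame that meets a drawn edge has a turning point on that edge: the point of the frame on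
the edge that is closest to an end of the edge. -/
theorem RectilinearGridDrawing.exists_turningPoint {V : Type} {G : SimpleGraph V}
    (d : RectilinearGridDrawing G) (f : Frame) {u v : V} (huv : G.Adj u v)
    (h : (f.points ∩ segment ℝ (d.pt u) (d.pt v)).Nonempty) :
    ∃ x, (x, s(u, v)) ∈ d.turningPoints f := by
  have hcpt : IsCompact (f.points ∩ segment ℝ (d.pt u) (d.pt v)) := by
    refine (isCompact_polyPoints _).inter_right ?_
    rw [segment_eq_image_lineMap]
    exact (isCompact_Icc.image AffineMap.lineMap_continuous).isClosed
  obtain ⟨x, ⟨hxf, hxe⟩, hmin⟩ := hcpt.exists_isMinOn h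
    (f := fun x => |x.1 - (d.pt u).1| + |x.2 - (d.pt u).2|) (by fun_prop)
  rw [isMinOn_iff] at hmin
  refine ⟨x, u, v, huv, rfl, ?_⟩
  by_cases hxu : x = d.pt u
  · exact Or.inl ⟨Or.inl hxu, hxf⟩
  by_cases hxv : x = d.pt v
  · exact Or.inl ⟨Or.inr hxv, hxf⟩
  have hne : d.pt u ≠ d.pt v := fun h =>
    huv.ne (d.injective (toPlane_injective h))
  have hbox := mem_gridSeg_iff (d.aligned u v huv) (x := x)
  obtain ⟨e, he, hxe'⟩ := id hxf
  have hbox' := mem_gridSeg_iff (f.isAxisCycle.axisParallel e he) (x := x)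
  have hxb := hbox.1 hxe
  have hxb' := hbox'.1 hxe'
  have hnn : ∀ (t : ℝ) (a b : ℕ), t ∈ Set.uIcc (a : ℝ) b → 0 ≤ t := fun t a b ht => by
    rcases Set.mem_uIcc.1 ht with ht | ht
    · exact (Nat.cast_nonneg _).trans ht.1
    · exact (Nat.cast_nonneg _).trans ht.1
  obtain ⟨r, hr1, hr2, hr3⟩ := exists_round_toward x.1 (hnn _ _ _ hxb.1) (d.pos u).1
  obtain ⟨s, hs1, hs2, hs3⟩ := exists_round_toward x.2 (hnn _ _ _ hxb.2) (d.pos u).2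
  -- Edges of `f` and of the drawing are boxes with integral bounds, so rounding towards `u` stays
  -- on both. By minimality the rounding does not move `x`, which is therefore a grid point.
  have hrs := hmin (toPlane (r, s))
    ⟨⟨e, he, (mem_gridSeg_iff (f.isAxisCycle.axisParallel e he)).2
      ⟨hr3 _ _ hxb'.1, hs3 _ _ hxb'.2⟩⟩,
     (mem_gridSeg_iff (d.aligned u v huv)).2 ⟨hr3 _ _ hxb.1, hs3 _ _ hxb.2⟩⟩
  simp only [RectilinearGridDrawing.pt, toPlane] at hrs
  obtain ⟨g, rfl⟩ : ∃ g, x = toPlane g :=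
    ⟨(r, s), Prod.ext (hr2 (by linarith)).symm (hs2 (by linarith)).symm⟩
  refine Or.inr ⟨⟨hxu, hxv⟩, ⟨mem_enrichedSeg hne hxe, Frame.mem_enriched hxf⟩, u, Or.inl rfl,
    d.pt u, right_mem_segment _ _ _, Ne.symm hxu, ?_⟩
  refine Set.Subset.antisymm ?_ ?_
  · rintro y ⟨⟨hy, -⟩, hyf⟩
    have hye : y ∈ segment ℝ (d.pt u) (d.pt v) :=
      (convex_segment _ _).segment_subset hxe (left_mem_segment _ _ _) hy
    have := hmin y ⟨f.enriched_subset hyf, hye⟩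
    obtain ⟨a, b, ha, hb, hab, rfl⟩ := hy
    -- A point `a • x + b • u` of the piece towards `u` has `a` times the distance of `x` to `u`, so
    -- minimality forces `a = 1`.
    have h1 : ∀ s t : ℝ, |a * s + b * t - t| = a * |s - t| := fun s t => by
      rw [← abs_of_nonneg ha, ← abs_mul, abs_of_nonneg ha]
      congr 1
      linear_combination t * hab
    simp only [Prod.fst_add, Prod.snd_add, Prod.smul_fst, Prod.smul_snd, smul_eq_mul, h1] at this
    have hpos : 0 < |(toPlane g).1 - (d.pt u).1| + |(toPlane g).2 - (d.pt u).2| := by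
      by_contra hle
      have h1 := abs_nonneg ((toPlane g).1 - (d.pt u).1)
      have h2 := abs_nonneg ((toPlane g).2 - (d.pt u).2)
      refine hxu (Prod.ext ?_ ?_)
      · exact sub_eq_zero.1 (abs_eq_zero.1 (by linarith))
      · exact sub_eq_zero.1 (abs_eq_zero.1 (by linarith))
    have ha1 : 1 ≤ a := by
      by_contra ha1
      nlinarith
    have hb0 : b = 0 := by linarith
    have ha1' : a = 1 := by linarith
    simp [hb0, ha1']
  · rintro y rfl
    exact ⟨mem_enrichedSeg hxu (left_mem_segment _ _ _), Frame.mem_enriched hxf⟩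

/-! ### Nested rectangles around a straight path -/

/-- The vertices of the drawing: the row from `(1, K + 1)` to `(K + m, K + 1)` and the corners of
the `K` rectangles `[j, 2K + m + 1 - j] × [j, 2K + 2 - j]`. -/
def NestedVertex (K m : ℕ) (p : GridPt) : Prop :=
  (p.2 = K + 1 ∧ 1 ≤ p.1 ∧ p.1 ≤ K + m) ∨
  (1 ≤ p.2 ∧ p.2 ≤ K ∧ (p.1 = p.2 ∨ p.1 + p.2 = 2 * K + m + 1)) ∨
  (K + 2 ≤ p.2 ∧ p.2 ≤ 2 * K + 1 ∧ (p.1 + p.2 = 2 * K + 2 ∨ p.1 + 1 = p.2 + m))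

/-- The edges of the `j`-th rectangle, whose left side is subdivided by a vertex of the row. -/
def RingEdge (K m j : ℕ) (p q : GridPt) : Prop :=
  1 ≤ j ∧ j ≤ K ∧
  ((p.1 = j ∧ p.2 = j ∧ q.1 = j ∧ q.2 = K + 1) ∨
   (p.1 = j ∧ p.2 = K + 1 ∧ q.1 = j ∧ q.2 + j = 2 * K + 2) ∨
   (p.1 = j ∧ p.2 = j ∧ q.1 + j = 2 * K + m + 1 ∧ q.2 = j) ∨
   (p.1 = j ∧ p.2 + j = 2 * K + 2 ∧ q.1 + j = 2 * K + m + 1 ∧ q.2 = p.2) ∨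
   (p.1 + j = 2 * K + m + 1 ∧ p.2 = j ∧ q.1 = p.1 ∧ q.2 + j = 2 * K + 2))

/-- The edges of the drawing, directed to the right and upwards. -/
def NestedEdge (K m : ℕ) (p q : GridPt) : Prop :=
  (p.2 = K + 1 ∧ q.2 = K + 1 ∧ q.1 = p.1 + 1 ∧ 1 ≤ p.1 ∧ p.1 < K + m) ∨
  ∃ j, RingEdge K m j p q

theorem NestedEdge.le {K m : ℕ} (hm : 2 ≤ m) {p q : GridPt} (h : NestedEdge K m p q) :
    p.1 ≤ q.1 ∧ p.2 ≤ q.2 ∧ (p.1 = q.1 ∨ p.2 = q.2) ∧ p ≠ q := by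
  obtain ⟨a, b⟩ := p
  obtain ⟨c, d⟩ := q
  simp only [NestedEdge, RingEdge, ne_eq, Prod.mk.injEq] at *
  obtain h | ⟨j, h⟩ := h
  · omega
  · omega

theorem NestedEdge.vertex {K m : ℕ} (hm : 2 ≤ m) {p q : GridPt} (h : NestedEdge K m p q) :
    NestedVertex K m p ∧ NestedVertex K m q := by
  obtain ⟨a, b⟩ := p
  obtain ⟨c, d⟩ := q
  simp only [NestedEdge, RingEdge, NestedVertex] at *
  obtain h | ⟨j, h⟩ := h
  · omega
  · omega

/-- An edge contains no vertex but its ends. -/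
theorem NestedEdge.eq_or_eq {K m : ℕ} (hm : 2 ≤ m) {p q g : GridPt} (h : NestedEdge K m p q)
    (hg : NestedVertex K m g) (h1 : p.1 ≤ g.1 ∧ g.1 ≤ q.1) (h2 : p.2 ≤ g.2 ∧ g.2 ≤ q.2) :
    g = p ∨ g = q := by
  obtain ⟨a, b⟩ := p
  obtain ⟨c, d⟩ := q
  obtain ⟨x, y⟩ := g
  simp only [NestedEdge, RingEdge, NestedVertex, Prod.mk.injEq] at *
  obtain h | ⟨j, h⟩ := h
  · omega
  · obtain ⟨hj1, hj2, h | h | h | h | h⟩ := h <;> omega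

/-- Two different edges share a grid point only if it is an end of both. -/
theorem NestedEdge.common {K m : ℕ} (hm : 2 ≤ m) {p q p' q' g : GridPt} (h : NestedEdge K m p q)
    (h' : NestedEdge K m p' q') (hne : (p, q) ≠ (p', q'))
    (h1 : p.1 ≤ g.1 ∧ g.1 ≤ q.1) (h2 : p.2 ≤ g.2 ∧ g.2 ≤ q.2)
    (h1' : p'.1 ≤ g.1 ∧ g.1 ≤ q'.1) (h2' : p'.2 ≤ g.2 ∧ g.2 ≤ q'.2) :
    (g = p ∨ g = q) ∧ (g = p' ∨ g = q') := by
  obtain ⟨a, b⟩ := p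
  obtain ⟨c, d⟩ := q
  obtain ⟨a', b'⟩ := p'
  obtain ⟨c', d'⟩ := q'
  obtain ⟨x, y⟩ := g
  simp only [NestedEdge, RingEdge, Prod.mk.injEq, ne_eq] at *
  obtain h | ⟨j, hj1, hj2, h | h | h | h | h⟩ := h <;>
  obtain h' | ⟨j', hj1', hj2', h' | h' | h' | h' | h'⟩ := h' <;> omega

theorem exists_nestedVertex_enum (K m n : ℕ) (hm : 2 ≤ m) (hn : n = 5 * K + m) :
    ∃ pos : Fin n → GridPt, Function.Injective pos ∧
      ∀ p, (∃ v, pos v = p) ↔ NestedVertex K m p := by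
  -- The `K + m` vertices of the row, and four corners for each rectangle `i + 1`: the Booleans
  -- choose left or right and bottom or top.
  let f : Fin (K + m) ⊕ (Fin K × Bool × Bool) → GridPt := Sum.elim (fun i => (i + 1, K + 1))
    fun x => (cond x.2.1 (x.1 + 1) (2 * K + m - x.1), cond x.2.2 (x.1 + 1) (2 * K + 1 - x.1))
  have hf : Function.Injective f := by
    rintro (⟨i, hi⟩ | ⟨⟨i, hi⟩, _ | _, _ | _⟩) (⟨j, hj⟩ | ⟨⟨j, hj⟩, _ | _, _ | _⟩) h <;>
      simp [f] at h ⊢ <;> omega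
  have hr : ∀ p, (∃ v, f v = p) ↔ NestedVertex K m p := by
    rintro ⟨x, y⟩
    constructor
    · rintro ⟨⟨i, hi⟩ | ⟨⟨i, hi⟩, _ | _, _ | _⟩, h⟩ <;>
        simp [f, NestedVertex] at h ⊢ <;> omega
    · rintro (h | ⟨h1, h2, h | h⟩ | ⟨h1, h2, h | h⟩) <;> simp only at h
      · exact ⟨Sum.inl ⟨x - 1, by omega⟩, by simp [f]; omega⟩
      · exact ⟨Sum.inr (⟨y - 1, by omega⟩, true, true), by simp [f]; omega⟩
      · exact ⟨Sum.inr (⟨y - 1, by omega⟩, false, true), by simp [f]; omega⟩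
      · exact ⟨Sum.inr (⟨2 * K + 1 - y, by omega⟩, true, false), by simp [f]; omega⟩
      · exact ⟨Sum.inr (⟨2 * K + 1 - y, by omega⟩, false, false), by simp [f]; omega⟩
  let e : Fin n ≃ Fin (K + m) ⊕ (Fin K × Bool × Bool) :=
    Fintype.equivOfCardEq (by simp; omega)
  refine ⟨f ∘ e, hf.comp e.injective, fun p => ?_⟩
  rw [← hr, e.surjective.exists]
  rfl

/-! ### The graph, its connectedness and its planar drawing -/

section

variable {n K m : ℕ} (pos : Fin n → GridPt)

/-- The graph of the drawing, with vertices named by `pos`. -/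
def nestedGraph (K m : ℕ) : SimpleGraph (Fin n) where
  Adj u v := u ≠ v ∧ (NestedEdge K m (pos u) (pos v) ∨ NestedEdge K m (pos v) (pos u))
  symm := ⟨fun _ _ h => ⟨h.1.symm, h.2.symm⟩⟩
  loopless := ⟨fun _ h => h.1 rfl⟩

variable {pos}

/-- The row meets the left side of every rectangle in a vertex, and the corners are reached from
there along the sides. -/
theorem nestedGraph_connected (hK : 1 ≤ K) (hm : 2 ≤ m) (hinj : Function.Injective pos)
    (hr : ∀ p, (∃ v, pos v = p) ↔ NestedVertex K m p) :
    (nestedGraph pos K m).Connected := by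
  have hadj : ∀ u v, NestedEdge K m (pos u) (pos v) → (nestedGraph pos K m).Reachable u v := by
    intro u v h
    refine SimpleGraph.Adj.reachable ⟨?_, Or.inl h⟩
    rintro rfl
    exact (h.le hm).2.2.2 rfl
  obtain ⟨o, ho⟩ := (hr (1, K + 1)).2 (Or.inl ⟨rfl, le_rfl, by simp; omega⟩)
  let R : GridPt → Prop := fun p => ∀ v, pos v = p → (nestedGraph pos K m).Reachable o v
  have hup : ∀ {p q}, NestedEdge K m p q → R p → R q := by
    rintro p q h hp v rfl
    obtain ⟨u, rfl⟩ := (hr p).2 (h.vertex hm).1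
    exact (hp u rfl).trans (hadj _ _ h)
  have hdown : ∀ {p q}, NestedEdge K m p q → R q → R p := by
    rintro p q h hq v rfl
    obtain ⟨u, rfl⟩ := (hr q).2 (h.vertex hm).2
    exact (hq u rfl).trans (hadj _ _ h).symm
  have hrow : ∀ i, i + 1 ≤ K + m → R (i + 1, K + 1) := by
    intro i
    induction i with
    | zero =>
      intro _ v hv
      rw [hinj (hv.trans ho.symm)]
    | succ i ih =>
      intro hi
      exact hup (Or.inl ⟨rfl, rfl, rfl, by simp, by simp; omega⟩) (ih (by omega))
  have hleft : ∀ j, 1 ≤ j → j ≤ K → R (j, K + 1) := by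
    intro j h1 h2
    obtain ⟨i, rfl⟩ := Nat.exists_eq_add_of_le' h1
    exact hrow i (by omega)
  have hll : ∀ j, 1 ≤ j → j ≤ K → R (j, j) := fun j h1 h2 =>
    hdown (Or.inr ⟨j, h1, h2, Or.inl ⟨rfl, rfl, rfl, rfl⟩⟩) (hleft j h1 h2)
  have hul : ∀ j, 1 ≤ j → j ≤ K → R (j, 2 * K + 2 - j) := fun j h1 h2 =>
    hup (Or.inr ⟨j, h1, h2, Or.inr (Or.inl ⟨rfl, rfl, rfl, by simp; omega⟩)⟩) (hleft j h1 h2)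
  have hall : ∀ v, (nestedGraph pos K m).Reachable o v := by
    intro v
    suffices h : R (pos v) from h v rfl
    generalize hv : pos v = p
    obtain ⟨x, y⟩ := p
    rcases (hr (x, y)).1 ⟨v, hv⟩ with ⟨h1, h2, h3⟩ | ⟨h1, h2, h | h⟩ | ⟨h1, h2, h | h⟩ <;>
      simp only at *
    · obtain ⟨i, rfl⟩ := Nat.exists_eq_add_of_le' h2
      subst h1
      exact hrow i h3
    · subst h
      exact hll x h1 h2
    · refine hup (Or.inr ⟨y, h1, h2, ?_⟩) (hll y h1 h2)
      simp; omega
    · refine (?_ : R (x, y))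
      obtain rfl : y = 2 * K + 2 - x := by omega
      exact hul x (by omega) (by omega)
    · refine hup (Or.inr ⟨2 * K + 2 - y, by omega, by omega, ?_⟩)
        (hul (2 * K + 2 - y) (by omega) (by omega))
      simp; omega
  exact { preconnected := fun u v => (hall u).symm.trans (hall v), nonempty := ⟨o⟩ }

/-- The drawing of `nestedGraph`. -/
def nestedDrawing (hm : 2 ≤ m) (hinj : Function.Injective pos) :
    RectilinearGridDrawing (nestedGraph pos K m) where
  pos := pos
  injective := hinj
  aligned _ _ h := h.2.elim (fun h => (h.le hm).2.2.1) fun h => (h.le hm).2.2.1.imp Eq.symm Eq.symm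

theorem NestedEdge.mem_gridSeg (hm : 2 ≤ m) {p q : GridPt} (h : NestedEdge K m p q) {x : ℝ × ℝ} :
    x ∈ gridSeg (p, q) ↔ ((p.1 : ℝ) ≤ x.1 ∧ x.1 ≤ q.1) ∧ ((p.2 : ℝ) ≤ x.2 ∧ x.2 ≤ q.2) := by
  have hle := h.le hm
  rw [mem_gridSeg_iff hle.2.2.1, Set.uIcc_of_le (by exact_mod_cast hle.1),
    Set.uIcc_of_le (by exact_mod_cast hle.2.1)]
  rfl

theorem NestedEdge.toPlane_mem (hm : 2 ≤ m) {p q : GridPt} (h : NestedEdge K m p q) {g : GridPt} :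
    toPlane g ∈ gridSeg (p, q) ↔ (p.1 ≤ g.1 ∧ g.1 ≤ q.1) ∧ (p.2 ≤ g.2 ∧ g.2 ≤ q.2) := by
  rw [h.mem_gridSeg hm]
  simp [toPlane]

/-- Two different edges meet only in a common end. -/
theorem NestedEdge.inter (hm : 2 ≤ m) {p q p' q' : GridPt} (h : NestedEdge K m p q)
    (h' : NestedEdge K m p' q') (hne : (p, q) ≠ (p', q')) {x : ℝ × ℝ}
    (hx : x ∈ gridSeg (p, q)) (hx' : x ∈ gridSeg (p', q')) :
    ∃ g, toPlane g = x ∧ (g = p ∨ g = q) ∧ (g = p' ∨ g = q') := by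
  rw [h.mem_gridSeg hm] at hx
  rw [h'.mem_gridSeg hm] at hx'
  have hx1 : 0 ≤ x.1 := (Nat.cast_nonneg _).trans hx.1.1
  have hx2 : 0 ≤ x.2 := (Nat.cast_nonneg _).trans hx.2.1
  -- Rounding a common point down and up gives two grid points on both edges, hence common ends. If
  -- they differ, they are the two ends of both edges, which then coincide.
  have hlo := h.common hm h' hne (g := (⌊x.1⌋₊, ⌊x.2⌋₊))
    ⟨Nat.le_floor hx.1.1, by exact_mod_cast (Nat.floor_le hx1).trans hx.1.2⟩
    ⟨Nat.le_floor hx.2.1, by exact_mod_cast (Nat.floor_le hx2).trans hx.2.2⟩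
    ⟨Nat.le_floor hx'.1.1, by exact_mod_cast (Nat.floor_le hx1).trans hx'.1.2⟩
    ⟨Nat.le_floor hx'.2.1, by exact_mod_cast (Nat.floor_le hx2).trans hx'.2.2⟩
  have hhi := h.common hm h' hne (g := (⌈x.1⌉₊, ⌈x.2⌉₊))
    ⟨by exact_mod_cast hx.1.1.trans (Nat.le_ceil _), Nat.ceil_le.2 hx.1.2⟩
    ⟨by exact_mod_cast hx.2.1.trans (Nat.le_ceil _), Nat.ceil_le.2 hx.2.2⟩
    ⟨by exact_mod_cast hx'.1.1.trans (Nat.le_ceil _), Nat.ceil_le.2 hx'.1.2⟩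
    ⟨by exact_mod_cast hx'.2.1.trans (Nat.le_ceil _), Nat.ceil_le.2 hx'.2.2⟩
  by_cases heq : ((⌊x.1⌋₊, ⌊x.2⌋₊) : GridPt) = (⌈x.1⌉₊, ⌈x.2⌉₊)
  · refine ⟨_, ?_, hlo⟩
    rw [Prod.mk.injEq] at heq
    refine Prod.ext (le_antisymm (Nat.floor_le hx1) ?_) (le_antisymm (Nat.floor_le hx2) ?_)
    · rw [toPlane, heq.1]; exact Nat.le_ceil _
    · rw [toPlane, heq.2]; exact Nat.le_ceil _
  · have hle := h.le hm
    have hle' := h'.le hm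
    have hf1 := Nat.floor_le_ceil x.1
    have hf2 := Nat.floor_le_ceil x.2
    generalize ((⌊x.1⌋₊ : ℕ)) = a at *
    generalize ((⌊x.2⌋₊ : ℕ)) = b at *
    generalize ((⌈x.1⌉₊ : ℕ)) = c at *
    generalize ((⌈x.2⌉₊ : ℕ)) = e at *
    exfalso
    obtain ⟨p1, p2⟩ := p
    obtain ⟨q1, q2⟩ := q
    obtain ⟨r1, r2⟩ := p'
    obtain ⟨s1, s2⟩ := q'
    simp only [Prod.mk.injEq, ne_eq] at *
    omega

theorem nestedDrawing_isPlanar (hm : 2 ≤ m) (hinj : Function.Injective pos)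
    (hr : ∀ p, (∃ v, pos v = p) ↔ NestedVertex K m p) :
    (nestedDrawing (K := K) hm hinj).IsPlanar := by
  constructor
  · have key : ∀ u v w, NestedEdge K m (pos u) (pos v) →
        toPlane (pos w) ∈ gridSeg (pos u, pos v) → w = u ∨ w = v := by
      intro u v w h hw
      have hw := (h.toPlane_mem hm).1 hw
      exact (h.eq_or_eq hm ((hr _).1 ⟨w, rfl⟩) hw.1 hw.2).imp (fun h => hinj h) fun h => hinj h
    rintro u v w ⟨-, h | h⟩ hw
    · exact key u v w h hw
    · exact (key v u w h (by rw [segment_symm] at hw; exact hw)).symm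
  · have key : ∀ u v u' v', NestedEdge K m (pos u) (pos v) → NestedEdge K m (pos u') (pos v') →
        s(u, v) ≠ s(u', v') → ∀ x ∈ gridSeg (pos u, pos v) ∩ gridSeg (pos u', pos v'),
          ∃ w, toPlane (pos w) = x ∧ w ∈ s(u, v) ∧ w ∈ s(u', v') := by
      rintro u v u' v' h h' hne x ⟨hx, hx'⟩
      have hne' : (pos u, pos v) ≠ (pos u', pos v') := by
        intro he
        rw [Prod.mk.injEq] at he
        exact hne (by rw [hinj he.1, hinj he.2])
      obtain ⟨g, rfl, hg, hg'⟩ := h.inter hm h' hne' hx hx'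
      obtain ⟨w, rfl⟩ : ∃ w, pos w = g := by
        rcases hg with rfl | rfl
        exacts [⟨u, rfl⟩, ⟨v, rfl⟩]
      exact ⟨w, rfl, Sym2.mem_iff.2 (hg.imp (fun h => hinj h) fun h => hinj h),
        Sym2.mem_iff.2 (hg'.imp (fun h => hinj h) fun h => hinj h)⟩
    have hs : ∀ u v, segment ℝ ((nestedDrawing (K := K) hm hinj).pt u)
        ((nestedDrawing (K := K) hm hinj).pt v) = gridSeg (pos u, pos v) := fun _ _ => rfl
    have hsymm : ∀ u v, gridSeg (pos u, pos v) = gridSeg (pos v, pos u) := fun _ _ =>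
      segment_symm _ _ _
    rintro u v u' v' ⟨-, h⟩ ⟨-, h'⟩ hne
    rw [hs, hs]
    rcases h with h | h <;> rcases h' with h' | h'
    · exact key _ _ _ _ h h' hne
    · rw [Sym2.eq_swap (a := u'), hsymm u'] at *
      exact key _ _ _ _ h h' hne
    · rw [Sym2.eq_swap (a := u), hsymm u] at *
      exact key _ _ _ _ h h' hne
    · rw [Sym2.eq_swap (a := u), hsymm u, Sym2.eq_swap (a := u'), hsymm u'] at *
      exact key _ _ _ _ h h' hne

theorem NestedVertex.bounds (hm : 2 ≤ m) {p : GridPt} (h : NestedVertex K m p) :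
    1 ≤ p.1 ∧ p.1 ≤ 2 * K + m ∧ 1 ≤ p.2 ∧ p.2 ≤ 2 * K + 1 := by
  obtain ⟨x, y⟩ := p
  simp only [NestedVertex] at *
  omega

theorem nestedDrawing_isNormalized (hK : 1 ≤ K) (hm : 2 ≤ m) (hinj : Function.Injective pos)
    (hr : ∀ p, (∃ v, pos v = p) ↔ NestedVertex K m p) :
    (nestedDrawing (K := K) hm hinj).IsNormalized := by
  obtain ⟨v, hv⟩ := (hr (1, 1)).2 (Or.inr (Or.inl ⟨le_rfl, hK, Or.inl rfl⟩))
  refine ⟨fun v => ?_, ⟨v, congrArg Prod.fst hv⟩, ⟨v, congrArg Prod.snd hv⟩⟩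
  have := ((hr _).1 ⟨v, rfl⟩).bounds hm
  exact ⟨this.1, this.2.2.1⟩

theorem nestedDrawing_rectangular (hK : 1 ≤ K) (hm : 2 ≤ m) (hinj : Function.Injective pos)
    (hr : ∀ p, (∃ v, pos v = p) ↔ NestedVertex K m p) :
    (nestedDrawing (K := K) hm hinj).rectangular =
      [(0, 0), (0, 2 * K + 2), (2 * K + m + 1, 2 * K + 2), (2 * K + m + 1, 0), (0, 0)] := by
  obtain ⟨v, hv⟩ := (hr (2 * K + m, 2 * K + 1)).2
    (Or.inr (Or.inr ⟨by simp; omega, le_rfl, Or.inr (by simp; omega)⟩))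
  have h1 : (Finset.univ.sup fun v => (pos v).1) = 2 * K + m := by
    refine le_antisymm (Finset.sup_le fun w _ => (((hr _).1 ⟨w, rfl⟩).bounds hm).2.1) ?_
    calc 2 * K + m = (pos v).1 := by rw [hv]
      _ ≤ _ := Finset.le_sup (f := fun v => (pos v).1) (Finset.mem_univ v)
  have h2 : (Finset.univ.sup fun v => (pos v).2) = 2 * K + 1 := by
    refine le_antisymm (Finset.sup_le fun w _ => (((hr _).1 ⟨w, rfl⟩).bounds hm).2.2.2) ?_
    calc 2 * K + 1 = (pos v).2 := by rw [hv]
      _ ≤ _ := Finset.le_sup (f := fun v => (pos v).2) (Finset.mem_univ v)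
  simp only [RectilinearGridDrawing.rectangular, nestedDrawing, h1, h2]

end

/-! ### Rectangles as level sets of the depth -/

/-- The distance to the boundary of `[0, 2K + m + 1] × [0, 2K + 2]`. -/
noncomputable def ringDepth (K m : ℕ) (x : ℝ × ℝ) : ℝ :=
  min (min x.1 (2 * K + m + 1 - x.1)) (min x.2 (2 * K + 2 - x.2))

theorem continuous_ringDepth (K m : ℕ) : Continuous (ringDepth K m) := by
  unfold ringDepth
  fun_prop

/-- The level set of depth `j` is the `j`-th rectangle: whichever of the four distances attains the
minimum names the side, and the left side is split at the row. -/
theorem exists_ringEdge {K m j : ℕ} (hm : 2 ≤ m) (hj1 : 1 ≤ j) (hjK : j ≤ K) {x : ℝ × ℝ}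
    (hx : ringDepth K m x = j) : ∃ p q, RingEdge K m j p q ∧ x ∈ gridSeg (p, q) := by
  suffices h : ∃ p q, RingEdge K m j p q ∧
      ((p.1 : ℝ) ≤ x.1 ∧ x.1 ≤ q.1) ∧ ((p.2 : ℝ) ≤ x.2 ∧ x.2 ≤ q.2) by
    obtain ⟨p, q, h, hx⟩ := h
    exact ⟨p, q, h, (NestedEdge.mem_gridSeg hm (Or.inr ⟨j, h⟩)).2 hx⟩
  obtain ⟨x, y⟩ := x
  have hle := hx.ge
  simp only [ringDepth, le_min_iff] at hle
  obtain ⟨⟨h1, h2⟩, h3, h4⟩ := hle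
  have hc1 : ((2 * K + m + 1 - j : ℕ) : ℝ) = 2 * K + m + 1 - j := by
    rw [Nat.cast_sub (by omega)]; push_cast; ring
  have hc2 : ((2 * K + 2 - j : ℕ) : ℝ) = 2 * K + 2 - j := by
    rw [Nat.cast_sub (by omega)]; push_cast; ring
  have hcase : x = j ∨ 2 * K + m + 1 - x = j ∨ y = j ∨ 2 * K + 2 - y = j := by
    simp only [ringDepth] at hx
    rcases min_choice (min x (2 * K + m + 1 - x)) (min y (2 * K + 2 - y)) with h | h <;>
      rw [h] at hx
    · rcases min_choice x (2 * K + m + 1 - x) with h | h <;> rw [h] at hx <;> tauto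
    · rcases min_choice y (2 * K + 2 - y) with h | h <;> rw [h] at hx <;> tauto
  rcases hcase with h | h | h | h
  · rcases le_total y (K + 1) with hy | hy
    · refine ⟨(j, j), (j, K + 1), ⟨hj1, hjK, by simp⟩, ?_⟩
      simp [h, h3, hy]
    · refine ⟨(j, K + 1), (j, 2 * K + 2 - j), ⟨hj1, hjK, by simp; omega⟩, ?_⟩
      simp only [hc2]
      push_cast
      refine ⟨⟨?_, ?_⟩, ?_, ?_⟩ <;> linarith
  · refine ⟨(2 * K + m + 1 - j, j), (2 * K + m + 1 - j, 2 * K + 2 - j),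
      ⟨hj1, hjK, by simp; omega⟩, ?_⟩
    simp only [hc1, hc2]
    refine ⟨⟨?_, ?_⟩, ?_, ?_⟩ <;> linarith
  · refine ⟨(j, j), (2 * K + m + 1 - j, j), ⟨hj1, hjK, by simp; omega⟩, ?_⟩
    simp only [hc1]
    refine ⟨⟨?_, ?_⟩, ?_, ?_⟩ <;> linarith
  · refine ⟨(j, 2 * K + 2 - j), (2 * K + m + 1 - j, 2 * K + 2 - j),
      ⟨hj1, hjK, by simp; omega⟩, ?_⟩
    simp only [hc1, hc2]
    refine ⟨⟨?_, ?_⟩, ?_, ?_⟩ <;> linarith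

/-- The index of the rectangle to which a grid point belongs. -/
def ringIndex (K m : ℕ) (p : GridPt) : ℕ :=
  min (min p.1 (2 * K + m + 1 - p.1)) (min p.2 (2 * K + 2 - p.2))

/-- Lets an edge determine its rectangle, so that turning points found on different rectangles are
distinct. -/
theorem RingEdge.ringIndex_eq {K m j : ℕ} (hm : 2 ≤ m) {p q : GridPt} (h : RingEdge K m j p q) :
    ringIndex K m p = j ∧ ringIndex K m q = j := by
  obtain ⟨a, b⟩ := p
  obtain ⟨c, d⟩ := q
  simp only [RingEdge, ringIndex] at *
  omega

/-! ### The parity of a rectangle -/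

theorem List.sum_map_eq_one_of_pairwise {ι : Type*} {f : ι → ZMod 2} {l : List ι}
    (h : l.Pairwise fun a b => f a ≠ 0 → f b = 0) {a : ι} (ha : a ∈ l) (hfa : f a = 1) :
    (l.map f).sum = 1 := by
  induction l with
  | nil => simp at ha
  | cons b l ih =>
    rw [List.pairwise_cons] at h
    rw [List.map_cons, List.sum_cons]
    by_cases hb : f b = 0
    · rcases List.mem_cons.1 ha with rfl | ha
      · simp [hfa] at hb
      · rw [hb, ih h.2 ha, zero_add]
    · have hl : ∀ c ∈ l, f c = 0 := fun c hc => h.1 c hc hb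
      rcases List.mem_cons.1 ha with rfl | ha
      · rw [List.map_congr_left (g := fun _ => 0) hl, hfa]
        simp
      · simp [hl a ha] at hfa

/-- The vertex sequence of the rectangle `[0, X] × [0, Y]`. -/
def rectangleVerts (X Y : ℕ) : List GridPt := [(0, 0), (0, Y), (X, Y), (X, 0), (0, 0)]

theorem mem_polyPoints_rectangleVerts {X Y : ℕ} {x : ℝ × ℝ} :
    x ∈ polyPoints (rectangleVerts X Y) ↔
      (x.1 = 0 ∧ 0 ≤ x.2 ∧ x.2 ≤ Y) ∨ (x.2 = Y ∧ 0 ≤ x.1 ∧ x.1 ≤ X) ∨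
      (x.1 = X ∧ 0 ≤ x.2 ∧ x.2 ≤ Y) ∨ (x.2 = 0 ∧ 0 ≤ x.1 ∧ x.1 ≤ X) := by
  have h0 : polyPoints [((0, 0) : GridPt)] = ∅ := by simp [polyPoints, polyEdges]
  rw [rectangleVerts, polyPoints_cons_cons, polyPoints_cons_cons, polyPoints_cons_cons,
    polyPoints_cons_cons, h0, Set.union_empty, Set.mem_union, Set.mem_union, Set.mem_union,
    mem_gridSeg_iff (by simp), mem_gridSeg_iff (by simp), mem_gridSeg_iff (by simp),
    mem_gridSeg_iff (by simp)]
  simp [and_comm]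

/-- An axis-parallel cycle whose points are those of a rectangle has odd parity at the points of
the open rectangle with half-integral first coordinate. -/
theorem IsAxisCycle.rayParity_eq_one {X Y : ℕ} {l : List GridPt} (hl : IsAxisCycle l)
    (hp : polyPoints l = polyPoints (rectangleVerts X Y)) {a : ℕ} (ha : a < X) {b : ℝ}
    (hb0 : 0 < b) (hbY : b < Y) : rayParity ((a : ℝ) + 1 / 2, b) l = 1 := by
  -- The upward ray passes through no grid point, so it meets `l` only inside horizontal edges on
  -- the top side, however `l` subdivides the rectangle.
  have hhalf : ∀ c : ℕ, (c : ℝ) ≠ (a : ℝ) + 1 / 2 := by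
    intro c hc
    have : (2 * c : ℝ) = 2 * a + 1 := by linarith
    have : 2 * c = 2 * a + 1 := by exact_mod_cast this
    omega
  have haX : (a : ℝ) + 1 ≤ X := by exact_mod_cast ha
  have ha0 : (0 : ℝ) ≤ a := Nat.cast_nonneg a
  have hmem : ∀ {y : ℝ}, ((a : ℝ) + 1 / 2, y) ∈ polyPoints l → b < y → y = Y := by
    intro y hy hby
    rw [hp, mem_polyPoints_rectangleVerts] at hy
    simp only at hy
    rcases hy with h | h | h | h
    · linarith
    · exact h.1
    · linarith
    · linarith
  have htop : ((a : ℝ) + 1 / 2, (Y : ℝ)) ∈ polyPoints l := by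
    rw [hp, mem_polyPoints_rectangleVerts]
    exact Or.inr (Or.inl ⟨rfl, by simp only; linarith, by simp only; linarith⟩)
  have hne : ∀ e ∈ polyEdges l, edgeParity ((a : ℝ) + 1 / 2, b) e ≠ 0 →
      ((a : ℝ) + 1 / 2, (Y : ℝ)) ∈ gridSeg e := by
    rintro ⟨p, q⟩ he h
    obtain ⟨h1, -, h3⟩ := edgeParity_ne_zero (hl.axisParallel _ he) h
    rwa [← hmem ⟨_, he, h3⟩ h1]
  obtain ⟨⟨p, q⟩, he, hx⟩ := htop
  refine List.sum_map_eq_one_of_pairwise ?_ he ?_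
  -- Two contributing edges would share the point of the top side on the ray, which is not a grid
  -- point.
  · refine hl.plane.imp_of_mem ?_
    intro e e' hee he' hinter h
    by_contra h'
    obtain ⟨g, hg, -⟩ := hinter _ ⟨hne e hee h, hne e' he' h'⟩
    exact hhalf g.1 (congrArg Prod.fst hg)
  · have hx := (mem_gridSeg_iff (hl.axisParallel _ he)).1 hx
    have hpq : p.2 = q.2 := by
      refine (hl.axisParallel _ he).resolve_left fun h => ?_
      simp only at h
      rw [h, Set.uIcc_self] at hx
      exact hhalf _ hx.1.symm
    have hy : b < p.2 := by
      rw [hpq, Set.uIcc_self] at hx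
      rw [hpq, ← show (Y : ℝ) = q.2 from hx.2]
      exact hbY
    have hleft : leftInd ((a : ℝ) + 1 / 2, b) p + leftInd ((a : ℝ) + 1 / 2, b) q = 1 := by
      rcases Set.mem_uIcc.1 hx.1 with ⟨h1, h2⟩ | ⟨h1, h2⟩
      · have h2 := not_le.2 (lt_of_le_of_ne h2 (hhalf _).symm)
        simp only [leftInd, if_pos h1, if_neg h2, add_zero]
      · have h2 := not_le.2 (lt_of_le_of_ne h2 (hhalf _).symm)
        simp only [leftInd, if_pos h1, if_neg h2, zero_add]
    simp only [edgeParity, aboveInd, if_pos hy, hleft, one_mul]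

/-! ### Cutters of a rectangle -/

theorem AssociatedFrames.polyPoints_subset {f f₁ f₂ : Frame} {c : List GridPt}
    (h : AssociatedFrames f c f₁ f₂) : polyPoints c ⊆ f₁.points := by
  obtain ⟨a, b, M, A, B, rfl, -, -, h1, -⟩ := h
  rw [h1]
  have : [a] ++ M ++ [b] ++ B ++ [a] = (a :: M) ++ b :: (B ++ [a]) := by simp
  rw [this, polyPoints_append_cons (a :: M) b]
  exact Set.subset_union_left

/-- A cutter of `f` starts on `f`. -/
theorem IsCutter.exists_mem {f f₁ f₂ : Frame} {c : List GridPt} (hc : IsCutter f c)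
    (h : AssociatedFrames f c f₁ f₂) : ∃ x ∈ polyPoints c, x ∈ f.points := by
  obtain ⟨a, b, M, A, B, rfl, -⟩ := h
  have : toPlane a ∈ f.points ∩ polyPoints ([a] ++ M ++ [b]) := by
    rw [hc.meets]
    exact ⟨a, Or.inl rfl, rfl⟩
  exact ⟨_, this.2, this.1⟩

/-- If `f` has odd parity at a point `z` of a connected set that avoids `f` and its cutter `c`, then
this set is strictly inside one of the frames associated with `f` and `c`. -/
theorem AssociatedFrames.strictlyInside {f f₁ f₂ : Frame} {c : List GridPt} (hc : IsAxisPath c)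
    (h : AssociatedFrames f c f₁ f₂) {C : Set (ℝ × ℝ)} (hC : IsPreconnected C) {z : ℝ × ℝ}
    (hz : z ∈ C) (hpar : ∀ l, IsAxisCycle l → polyPoints l = f.points → rayParity z l = 1)
    (hf : ∀ x ∈ C, x ∉ f.points) (hcut : ∀ x ∈ C, x ∉ polyPoints c) :
    (∀ x ∈ C, f₁.StrictlyInside x) ∨ ∀ x ∈ C, f₂.StrictlyInside x := by
  obtain ⟨a, b, M, A, B, rfl, hcyc, hpts, h1, h2, -⟩ := h
  have e0 : [a] ++ A ++ [b] ++ B ++ [a] = (a :: A) ++ b :: (B ++ [a]) := by simp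
  have e1 : [a] ++ M ++ [b] ++ B ++ [a] = (a :: M) ++ b :: (B ++ [a]) := by simp
  have e2 : [a] ++ M ++ [b] ++ A.reverse ++ [a] = (a :: M) ++ b :: (A.reverse ++ [a]) := by simp
  have er : b :: (A.reverse ++ [a]) = (a :: A ++ [b]).reverse := by simp
  have ec : [a] ++ M ++ [b] = a :: M ++ [b] := by simp
  have hpar := hpar _ hcyc hpts
  have hap := hcyc.axisParallel
  have hapc := hc.axisParallel
  rw [e0] at hpts hpar hap
  rw [e1] at h1
  rw [e2] at h2
  rw [ec] at hcut hapc
  rw [polyPoints_append_cons] at hpts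
  rw [axisParallel_append_cons] at hap
  -- The cutter is counted twice and cancels; the arcs through `A` and `B` remain and make up `f`.
  have hs : rayParity z ((a :: M) ++ b :: (B ++ [a])) +
      rayParity z ((a :: M) ++ b :: (A.reverse ++ [a])) = 1 := by
    rw [← hpar, rayParity_append_cons, rayParity_append_cons z _ b (A.reverse ++ [a]),
      rayParity_append_cons z (a :: A), er, rayParity_reverse z hap.1]
    have := CharTwo.add_self_eq_zero (rayParity z (a :: M ++ [b]))
    linear_combination this
  have hor : rayParity z ((a :: M) ++ b :: (B ++ [a])) = 1 ∨
      rayParity z ((a :: M) ++ b :: (A.reverse ++ [a])) = 1 := by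
    revert hs
    generalize rayParity z ((a :: M) ++ b :: (B ++ [a])) = s
    generalize rayParity z ((a :: M) ++ b :: (A.reverse ++ [a])) = t
    revert s t
    decide
  refine hor.imp (fun h x hx => ?_) fun h x hx => ?_
  · refine Frame.strictlyInside_of_rayParity h1 (by rw [← e1, List.getLast?_concat]; rfl)
      (axisParallel_append_cons.2 ⟨hapc, hap.2⟩) hC (fun y hy hy' => ?_) hz h hx
    rw [polyPoints_append_cons] at hy'
    exact hy'.elim (hcut y hy) fun hy' => hf y hy (hpts ▸ Or.inr hy')
  · refine Frame.strictlyInside_of_rayParity h2 (by rw [← e2, List.getLast?_concat]; rfl)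
      (axisParallel_append_cons.2 ⟨hapc, er ▸ hap.1.reverse⟩) hC (fun y hy hy' => ?_) hz h hx
    rw [polyPoints_append_cons, er, polyPoints_reverse] at hy'
    exact hy'.elim (hcut y hy) fun hy' => hf y hy (hpts ▸ Or.inl hy')

/-! ### The lower bound -/

/-- The segment that carries the innermost part of the row. -/
def nestedCore (K m : ℕ) : Set (ℝ × ℝ) := gridSeg ((K + 1, K + 1), (K + m, K + 1))

theorem mem_nestedCore {K m : ℕ} (hm : 2 ≤ m) {x : ℝ × ℝ} :
    x ∈ nestedCore K m ↔ ((K : ℝ) + 1 ≤ x.1 ∧ x.1 ≤ K + m) ∧ x.2 = K + 1 := by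
  rw [nestedCore, mem_gridSeg_iff (p := (K + 1, K + 1)) (q := (K + m, K + 1)) (Or.inr rfl)]
  have : (K : ℝ) + 1 ≤ K + m := by exact_mod_cast (by omega : K + 1 ≤ K + m)
  push_cast
  rw [Set.uIcc_of_le this, Set.uIcc_self]
  rfl

theorem lt_ringDepth_of_mem_nestedCore {K m : ℕ} (hm : 2 ≤ m) {x : ℝ × ℝ}
    (hx : x ∈ nestedCore K m) : (K : ℝ) < ringDepth K m x := by
  obtain ⟨⟨h1, h2⟩, h3⟩ := (mem_nestedCore hm).1 hx
  simp only [ringDepth, lt_min_iff]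
  refine ⟨⟨?_, ?_⟩, ?_, ?_⟩ <;> linarith

theorem ringDepth_le_of_mem_rectangle {K m : ℕ} {x : ℝ × ℝ}
    (hx : x ∈ polyPoints (rectangleVerts (2 * K + m + 1) (2 * K + 2))) : ringDepth K m x ≤ 0 := by
  rw [mem_polyPoints_rectangleVerts] at hx
  push_cast at hx
  rcases hx with h | h | h | h <;> simp [ringDepth, h.1]

section

variable {n K m : ℕ} {pos : Fin n → GridPt}

/-- A frame that contains a connected set from the boundary of the drawing to the core meets every
rectangle. -/
theorem le_cost_of_crossing (hm : 2 ≤ m) (hinj : Function.Injective pos)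
    (hr : ∀ p, (∃ v, pos v = p) ↔ NestedVertex K m p) {f : Frame} {P : Set (ℝ × ℝ)}
    (hP : IsPreconnected P) (hPf : P ⊆ f.points) {x y : ℝ × ℝ} (hx : x ∈ P) (hy : y ∈ P)
    (hx0 : ringDepth K m x ≤ 0) (hyK : K ≤ ringDepth K m y) :
    (K : ℕ∞) ≤ (nestedDrawing (K := K) hm hinj).cost f := by
  have key : ∀ j : Fin K, ∃ t ∈ (nestedDrawing (K := K) hm hinj).turningPoints f,
      ∀ w ∈ t.2, ringIndex K m (pos w) = j + 1 := by
    intro j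
    have hj : (j : ℝ) + 1 ≤ K := by exact_mod_cast j.2
    -- The depth runs from at most `0` to at least `K` along `P`, so it takes the value `j + 1`.
    obtain ⟨w, hwP, hw⟩ := hP.intermediate_value hx hy (continuous_ringDepth K m).continuousOn
      (show ((j + 1 : ℕ) : ℝ) ∈ _ from ⟨hx0.trans (Nat.cast_nonneg _), by push_cast; linarith⟩)
    obtain ⟨p, q, hpq, hwpq⟩ := exists_ringEdge hm (by omega) (by omega) hw
    have hE : NestedEdge K m p q := Or.inr ⟨_, hpq⟩
    obtain ⟨u, rfl⟩ := (hr p).2 (hE.vertex hm).1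
    obtain ⟨v, rfl⟩ := (hr q).2 (hE.vertex hm).2
    have huv : (nestedGraph pos K m).Adj u v :=
      ⟨fun h => (hE.le hm).2.2.2 (h ▸ rfl), Or.inl hE⟩
    obtain ⟨t, ht⟩ := (nestedDrawing (K := K) hm hinj).exists_turningPoint f huv
      ⟨w, hPf hwP, hwpq⟩
    refine ⟨_, ht, fun w hw => ?_⟩
    rcases Sym2.mem_iff.1 hw with rfl | rfl
    · exact (hpq.ringIndex_eq hm).1
    · exact (hpq.ringIndex_eq hm).2
  choose t ht htw using key
  have ht_inj : Function.Injective t := by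
    intro i j hij
    have hw := Sym2.out_fst_mem (t i).2
    have h1 := htw i _ hw
    have h2 := htw j _ (by rw [← hij]; exact hw)
    exact Fin.ext (by omega)
  calc (K : ℕ∞) = ENat.card (Fin K) := by simp
    _ ≤ (Set.range t).encard := ht_inj.encard_range
    _ ≤ ((nestedDrawing (K := K) hm hinj).turningPoints f).encard :=
      Set.encard_le_encard (Set.range_subset_iff.2 ht)
    _ ≤ _ := le_add_self

/-- The last `m` vertices of the row are drawn on the core. -/
theorem le_ncard_verIn (hm : 2 ≤ m) (hinj : Function.Injective pos)
    (hr : ∀ p, (∃ v, pos v = p) ↔ NestedVertex K m p) {f : Frame}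
    (hf : ∀ x ∈ nestedCore K m, f.StrictlyInside x) :
    m ≤ ((nestedDrawing (K := K) hm hinj).verIn f).ncard := by
  have hex : ∀ i : Fin m, ∃ v, pos v = (K + 1 + i, K + 1) := fun i =>
    (hr _).2 (Or.inl ⟨rfl, by simp; omega, by simp; omega⟩)
  choose v hv using hex
  have hvinj : Function.Injective v := by
    intro i j hij
    have := (hv i).symm.trans (hij ▸ hv j)
    simp only [Prod.mk.injEq] at this
    exact Fin.ext (by omega)
  calc m = (Set.range v).ncard := by
        rw [Set.ncard_range_of_injective hvinj]; simp
    _ ≤ _ := by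
      refine Set.ncard_le_ncard (Set.range_subset_iff.2 fun i => ?_) (Set.toFinite _)
      refine hf _ ((mem_nestedCore hm).2 ?_)
      have h : (i : ℝ) + 1 ≤ m := by exact_mod_cast i.2
      have h0 : (0 : ℝ) ≤ i := Nat.cast_nonneg _
      simp only [RectilinearGridDrawing.pt, nestedDrawing, hv, toPlane]
      push_cast
      refine ⟨⟨?_, ?_⟩, rfl⟩ <;> linarith

theorem le_width_of_isBalanced (hK : 1 ≤ K) (hm : 10 * K < m) (hm2 : 2 ≤ m) (hn : n = 5 * K + m)
    (hinj : Function.Injective pos) (hr : ∀ p, (∃ v, pos v = p) ↔ NestedVertex K m p)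
    (D : DrawnTreeDecomposition (nestedDrawing (K := K) hm2 hinj)) (hD : D.IsBalanced) :
    (K : ℕ∞) ≤ D.width := by
  have hroot : (D.α D.root).points = polyPoints (rectangleVerts (2 * K + m + 1) (2 * K + 2)) := by
    rw [D.root_frame, nestedDrawing_rectangular hK hm2 hinj hr]
    rfl
  have hm' : (2 : ℝ) ≤ m := by exact_mod_cast hm2
  -- A point of the core with half-integral first coordinate, as the parity of a rectangle requires.
  set z : ℝ × ℝ := (((K + 1 : ℕ) : ℝ) + 1 / 2, (K : ℝ) + 1) with hz
  have hzC : z ∈ nestedCore K m := by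
    rw [mem_nestedCore hm2, hz]
    push_cast
    refine ⟨⟨?_, ?_⟩, rfl⟩ <;> linarith
  have hC : IsPreconnected (nestedCore K m) := (convex_segment _ _).isPreconnected
  have hpar : ∀ l, IsAxisCycle l → polyPoints l = (D.α D.root).points → rayParity z l = 1 := by
    intro l hl hp
    have hK0 : (0 : ℝ) ≤ K := Nat.cast_nonneg _
    exact hl.rayParity_eq_one (hp.trans hroot) (by omega) (by positivity) (by push_cast; linarith)
  have hCroot : ∀ x ∈ nestedCore K m, x ∉ (D.α D.root).points := by
    intro x hx hx'
    have h1 := lt_ringDepth_of_mem_nestedCore hm2 hx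
    have h2 := ringDepth_le_of_mem_rectangle (hroot ▸ hx')
    have hK0 : (0 : ℝ) ≤ K := Nat.cast_nonneg _
    linarith
  have hint : ∃ y, IsChild D.T D.root D.root y := by
    by_contra hleaf
    refine (D.leaf_iff D.root).1 hleaf ⟨(K + 1, K + 1), ?_⟩
    exact Frame.strictlyInside_of_rayParity rfl (D.α D.root).isAxisCycle.closed
      (D.α D.root).isAxisCycle.axisParallel hC hCroot hzC
      (hpar _ (D.α D.root).isAxisCycle rfl) (left_mem_segment _ _ _)
  obtain ⟨x₁, x₂, -, hch, c, hcut, hass, -⟩ := D.internal D.root hint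
  by_cases hmeet : ∃ y ∈ nestedCore K m, y ∈ polyPoints c
  · obtain ⟨y, hyC, hy⟩ := hmeet
    obtain ⟨x, hx, hxf⟩ := hcut.exists_mem hass
    refine (le_cost_of_crossing hm2 hinj hr (isPreconnected_polyPoints c) hass.polyPoints_subset
      hx hy (ringDepth_le_of_mem_rectangle (hroot ▸ hxf))
      (lt_ringDepth_of_mem_nestedCore hm2 hyC).le).trans ?_
    exact le_iSup (fun x => (nestedDrawing (K := K) hm2 hinj).cost (D.α x)) x₁
  · exfalso
    -- Bounding the vertices inside the root frame by `n`, balance would give `m ≤ 2/3 * (5 * K +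
    -- m)`, that is `m ≤ 10 * K`.
    have hbal : ∀ y, IsChild D.T D.root D.root y →
        (∀ x ∈ nestedCore K m, (D.α y).StrictlyInside x) → False := by
      intro y hy hin
      have h1 : (m : ℝ) ≤ ((nestedDrawing (K := K) hm2 hinj).verIn (D.α y)).ncard := by
        exact_mod_cast le_ncard_verIn hm2 hinj hr hin
      have h2 : (((nestedDrawing (K := K) hm2 hinj).verIn (D.α D.root)).ncard : ℝ) ≤ n := by
        exact_mod_cast (Set.ncard_le_card _).trans (by simp)
      have h3 := hD _ _ hy
      have h4 : (n : ℝ) = 5 * K + m := by exact_mod_cast hn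
      have h5 : (10 * K : ℝ) < m := by exact_mod_cast hm
      linarith
    rcases hass.strictlyInside hcut.isAxisPath hC hzC hpar hCroot
      (fun x hx hx' => hmeet ⟨x, hx, hx'⟩) with h | h
    · exact hbal x₁ ((hch _).2 (Or.inl rfl)) h
    · exact hbal x₂ ((hch _).2 (Or.inr rfl)) h

end

theorem mainTheorem11 :
    ∃ c : ℝ, 0 < c ∧ ∃ n₀ : ℕ, ∀ n : ℕ, n₀ ≤ n →
      ∃ G : SimpleGraph (Fin n), G.Connected ∧
        ∃ d : RectilinearGridDrawing G, d.IsNormalized ∧ d.IsPlanar ∧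
          ∀ D : DrawnTreeDecomposition d, D.IsBalanced →
            ENNReal.ofReal (c * n) ≤ (D.width : ℝ≥0∞) := by
  refine ⟨1 / 40, by norm_num, 40, fun n hn => ?_⟩
  -- With `K = ⌊n / 20⌋` one has `m = n - 5 * K ≥ 15 * K`, and `n < 20 * (K + 1) ≤ 40 * K` gives the
  -- constant `1 / 40`.
  obtain ⟨K, m, hK, hm, hnKm, hle⟩ : ∃ K m : ℕ, 1 ≤ K ∧ 10 * K < m ∧ n = 5 * K + m ∧ n ≤ 40 * K :=
    ⟨n / 20, n - 5 * (n / 20), by omega, by omega, by omega, by omega⟩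
  have hm2 : 2 ≤ m := by omega
  obtain ⟨pos, hinj, hr⟩ := exists_nestedVertex_enum K m n hm2 hnKm
  refine ⟨nestedGraph pos K m, nestedGraph_connected hK hm2 hinj hr, nestedDrawing hm2 hinj,
    nestedDrawing_isNormalized hK hm2 hinj hr, nestedDrawing_isPlanar hm2 hinj hr, fun D hD => ?_⟩
  have hle' : (n : ℝ) ≤ 40 * K := by exact_mod_cast hle
  calc ENNReal.ofReal (1 / 40 * n) ≤ ENNReal.ofReal K := ENNReal.ofReal_le_ofReal (by linarith)
    _ = ((K : ℕ∞) : ℝ≥0∞) := by simp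
    _ ≤ D.width :=
      ENat.toENNReal_le.2 (le_width_of_isBalanced hK hm hm2 hnKm hinj hr D hD)
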